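/- Let $n\ge 1$, let $\mathbb D^n\subset\mathbb C^n$ be the unit polydisc, and let $K_0,K_1\subset\mathbb D^n$ be non-pluripolar compact Reinhardt sets which are complete logarithmically convex, i.e. $\operatorname{Log}K_j=\{s\in(-\infty,0)^n:(e^{s_1},\dots,e^{s_n})\in K_j\}$ is convex and $\operatorname{Log}K_j+(-\infty,0)^n\subset\operatorname{Log}K_j$. Let $c_0,c_1>0$ and $c_t=(1-t)c_0+tc_1$. For $K\subset\mathbb D^n$ let $\omega_K(z)=\limsup_{y\to z}\sup\{u(y): u\text{ plurisubharmonic in }\mathbb D^n,\ u\le 0,\ u|_K\le -1\}$ be its relative extremal function. Put $u_j=c_j\,\omega_{K_j}$, $j=0,1$, and let $u_t^c$, $0<t<1$, be the geodesic between them: with $A=\{\zeta\in\mathbb C:0<\log|\zeta|<1\}$, $u_t^c(z)$ is the supremum of $u(z,e^t)$ over all plurisubharmonic functions $u$ on $\mathbb D^n\times A$ with $\limsup_{\log|\zeta|\to j}u(z,\zeta)\le u_j(z)$ for all $z\in\mathbb D^n$ and $j=0,1$. Let $K_t^c=\{z\in\mathbb D^n:u_t^c(z)=\min_{\mathbb D^n}u_t^c\}$.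 Then $$u_\tau^c=c_\tau\,\omega_{K_\tau^c}\ \text{ on }\mathbb D^n\text{ for some }\tau\in(0,1)\quad\Longleftrightarrow\quad c_0\operatorname{Log}K_1=c_1\operatorname{Log}K_0 .$$ If, moreover, each $K_j$ is the closure of $K_j\cap(\mathbb C\setminus\{0\})^n$, then this is also equivalent to $K_1^{c_0}=K_0^{c_1}$, where $K^{c}=\{z\in\mathbb C^n:|z_l|=|\eta_l|^c,\ 1\le l\le n,\text{ for some }\eta\in K\}$. -/

import Mathlib

open Filter Set
open scoped Topology Pointwise

noncomputable section

/-- Plurisubharmonic functions on an open subset `U` of a complex normed space, with values in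
`[-∞, ∞)`; the constant `-∞` is allowed. The sub-mean value inequality on closed complex discs in
`U` is expressed with the bounded truncations `max u N`, whose averages decrease to the average
of `u` as `N → -∞`. -/
structure IsPlurisubharmonicOn {E : Type*} [NormedAddCommGroup E] [NormedSpace ℂ E]
    (u : E → EReal) (U : Set E) : Prop where
  lt_top : ∀ z ∈ U, u z < ⊤
  upperSemicontinuousOn : UpperSemicontinuousOn u U
  submean : ∀ a b : E, (∀ l : ℂ, ‖l‖ ≤ 1 → a + l • b ∈ U) → ∀ N : ℝ,
    u a ≤ ((Real.circleAverage (fun l : ℂ => (max (u (a + l • b)) (N : EReal)).toReal) 0 1 : ℝ) :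
      EReal)

/-- Pluripolar sets: locally contained in the `-∞` set of a plurisubharmonic function which is not
identically `-∞`. -/
def IsPluripolar {E : Type*} [NormedAddCommGroup E] [NormedSpace ℂ E] (K : Set E) : Prop :=
  ∀ a ∈ K, ∃ V : Set E, IsOpen V ∧ IsConnected V ∧ a ∈ V ∧
    ∃ u : E → EReal, IsPlurisubharmonicOn u V ∧ (∃ z ∈ V, u z ≠ ⊥) ∧ ∀ z ∈ K ∩ V, u z = ⊥

/-- The envelope of the negative plurisubharmonic functions on `Ω` that are at most `-1` on `K`. -/
def relExtremalEnvelope {E : Type*} [NormedAddCommGroup E] [NormedSpace ℂ E]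
    (Ω K : Set E) (y : E) : EReal :=
  sSup {x | ∃ u : E → EReal, IsPlurisubharmonicOn u Ω ∧ (∀ z ∈ Ω, u z ≤ 0) ∧
    (∀ z ∈ K, u z ≤ -1) ∧ x = u y}

/-- The relative extremal function `ω_{K,Ω}`, for points of the open set `Ω`. -/
def relExtremal {E : Type*} [NormedAddCommGroup E] [NormedSpace ℂ E]
    (Ω K : Set E) (z : E) : EReal :=
  limsup (relExtremalEnvelope Ω K) (𝓝 z)

/-- The annulus `{ζ : 0 < log |ζ| < 1}`. -/
def annulus : Set ℂ := {ζ | 0 < Real.log ‖ζ‖ ∧ Real.log ‖ζ‖ < 1}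

/-- Convergence of points `ζ` of the annulus to the circle `log |ζ| = j`. -/
def toCircle (j : ℝ) : Filter ℂ := comap (fun ζ : ℂ => Real.log ‖ζ‖) (𝓝 j) ⊓ 𝓟 annulus

/-- The class of plurisubharmonic functions on `Ω × A` (`A` the annulus) whose boundary values on
the two circles are dominated by `u₀` and `u₁`. -/
def geodesicClass {E : Type*} [NormedAddCommGroup E] [NormedSpace ℂ E]
    (Ω : Set E) (u₀ u₁ : E → EReal) : Set (E × ℂ → EReal) :=
  {u | IsPlurisubharmonicOn u (Ω ×ˢ annulus) ∧
    (∀ z ∈ Ω, limsup (fun ζ => u (z, ζ)) (toCircle 0) ≤ u₀ z) ∧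
    (∀ z ∈ Ω, limsup (fun ζ => u (z, ζ)) (toCircle 1) ≤ u₁ z)}

/-- The plurisubharmonic geodesic `u_t` between `u₀` and `u₁`, for `0 < t < 1`. -/
def geodesic {E : Type*} [NormedAddCommGroup E] [NormedSpace ℂ E]
    (Ω : Set E) (u₀ u₁ : E → EReal) (t : ℝ) (z : E) : EReal :=
  sSup {x | ∃ u ∈ geodesicClass Ω u₀ u₁, x = u (z, ((Real.exp t : ℝ) : ℂ))}

/-- The unit polydisc in `ℂⁿ`. -/
def polydisc (n : ℕ) : Set (Fin n → ℂ) := {z | ∀ i, ‖z i‖ < 1}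

/-- Reinhardt (multicircled, toric) sets. -/
def IsReinhardt {n : ℕ} (K : Set (Fin n → ℂ)) : Prop :=
  ∀ z ∈ K, ∀ w : Fin n → ℂ, (∀ i, ‖w i‖ = ‖z i‖) → w ∈ K

/-- The open negative orthant `ℝⁿ₋`. -/
def negOrthant (n : ℕ) : Set (Fin n → ℝ) := {s | ∀ i, s i < 0}

/-- The logarithmic image `Log K ⊆ ℝⁿ₋`. -/
def logImage {n : ℕ} (K : Set (Fin n → ℂ)) : Set (Fin n → ℝ) :=
  {s | s ∈ negOrthant n ∧ (fun i => ((Real.exp (s i) : ℝ) : ℂ)) ∈ K}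

/-- Complete logarithmic convexity: `Log K` is convex and `Log K + ℝⁿ₋ ⊆ Log K`. -/
def IsCompleteLogConvex {n : ℕ} (K : Set (Fin n → ℂ)) : Prop :=
  Convex ℝ (logImage K) ∧ logImage K + negOrthant n ⊆ logImage K

/-- `K` is the closure of its part off the coordinate hyperplanes. -/
def IsClosureOfTorusPart {n : ℕ} (K : Set (Fin n → ℂ)) : Prop :=
  K = closure (K ∩ {z | ∀ i, z i ≠ 0})

/-- The multiplicative power `K^c = {z : |z_l| = |η_l|^c for all l, η ∈ K}`. -/
def reinhardtPow {n : ℕ} (K : Set (Fin n → ℂ)) (c : ℝ) : Set (Fin n → ℂ) :=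
  {z | ∃ η ∈ K, ∀ i, ‖z i‖ = ‖η i‖ ^ c}

/-- The weighted geodesic `u_t^c` between `c₀ ω_{K₀}` and `c₁ ω_{K₁}` in the unit polydisc. -/
def weightedGeodesic {n : ℕ} (K₀ K₁ : Set (Fin n → ℂ)) (c₀ c₁ t : ℝ) : (Fin n → ℂ) → EReal :=
  geodesic (polydisc n) (fun z => (c₀ : EReal) * relExtremal (polydisc n) K₀ z)
    (fun z => (c₁ : EReal) * relExtremal (polydisc n) K₁ z) t

/-- The interpolating set `K_t^c`: the points of the polydisc where `u_t^c` attains its minimum. -/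
def interpolatingSet {n : ℕ} (K₀ K₁ : Set (Fin n → ℂ)) (c₀ c₁ t : ℝ) : Set (Fin n → ℂ) :=
  {z | z ∈ polydisc n ∧ weightedGeodesic K₀ K₁ c₀ c₁ t z =
    ⨅ w ∈ polydisc n, weightedGeodesic K₀ K₁ c₀ c₁ t w}

/-- For some `τ ∈ (0,1)`, `u_τ^c = c_τ ω_{K_τ^c}` on the polydisc, with
`c_τ = (1 - τ) c₀ + τ c₁`. -/
def GeodesicIsExtremalSomewhere {n : ℕ} (K₀ K₁ : Set (Fin n → ℂ)) (c₀ c₁ : ℝ) : Prop :=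
  ∃ τ : ℝ, 0 < τ ∧ τ < 1 ∧ ∀ z ∈ polydisc n,
    weightedGeodesic K₀ K₁ c₀ c₁ τ z =
      (((1 - τ) * c₀ + τ * c₁ : ℝ) : EReal) *
        relExtremal (polydisc n) (interpolatingSet K₀ K₁ c₀ c₁ τ) z

end

/-! ### Circle averages -/

/-! In the coordinates s_i = log|z_i| the problem becomes convex geometry on the negative orthant.
Two tools carry it.

Lower bounds come from explicit competitors (`toricEnv`, `toricEnv_le_weightedGeodesic`): if a is a
positive linear form, e_j ≤ 0 and a·x + e_j ≤ -c_j on Log K_j, then max(-c_t, a·log|z| + (1-t)e_0 +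
t e_1) lies below the geodesic. Upper bounds come from `three_tori`: a plurisubharmonic function,
with no symmetry assumed, that is bounded by α and β near two tori is bounded by the linear
interpolation on the tori between them. On the product with the annulus it is fed with the bounds
-c_j over Log K_j and 0 everywhere. Together they show that the minimum of u_t is -c_t, so K_t is
the set where u_t = -c_t.

Extremality implies proportionality. Let h_j be the supremum of a positive form a on Log K_j, with a
scaled so that (1-τ)h_0 + τh_1 = -c_τ. Competitors with slope εa give a·log|w| ≤ -c_τ on K_τ, hence
a·log|z| ≤ c_τ ω_{K_τ} = u_τ. Interpolating between points near Log K_0 and points near the origin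
gives u_τ ≤ -(1-τ)c_0 near (1-τ) Log K_0, so h_0 ≤ -c_0; symmetrically h_1 ≤ -c_1. The normalization
forces both equalities, so c_1 h_0 = c_0 h_1 for every positive form. Such forms separate points
from the Log K_j, and the dilated sets coincide.

Conversely, proportional sets have the same polar set P of positive forms (at most -c_j on Log K_j),
and sup P is homogeneous of degree one. Bounding along rays that end at the origin shows that u_τ is
at most the envelope built from P, which is also a competitor; the same ray bound identifies c_τ
ω_{K_τ} with this envelope.

Coordinatewise powers are dilations in logarithmic coordinates; the closure hypothesis extends the
comparison to the coordinate hyperplanes. -/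

theorem circleIntegrable_log_norm_affine (a b : ℂ) :
    CircleIntegrable (fun l : ℂ => Real.log ‖a + l * b‖) 0 1 :=
  MeromorphicOn.circleIntegrable_log_norm (f := fun l : ℂ => a + l * b) (fun z _ => by fun_prop)

theorem circleAverage_log_norm_affine (a : ℂ) {b : ℂ} (hb : b ≠ 0) :
    Real.circleAverage (fun l : ℂ => Real.log ‖a + l * b‖) 0 1 =
      Real.log ‖b‖ + Real.posLog ‖a / b‖ := by
  have h1 : Real.circleAverage (fun l : ℂ => Real.log ‖a + l * b‖) 0 1 =
      Real.circleAverage ((fun _ : ℂ => Real.log ‖b‖) + fun l : ℂ => Real.log ‖l + a / b‖) 0 1 := by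
    -- `Real.log` fails to be additive at the zero of the affine function; that single point is
    -- negligible for the average.
    apply Real.circleAverage_congr_codiscreteWithin _ one_ne_zero
    have h2 : ({-(a / b)} : Set ℂ)ᶜ ∈ codiscreteWithin (Metric.sphere (0 : ℂ) |1|) := by
      apply Filter.codiscreteWithin_mono (subset_univ _)
      exact (Set.finite_singleton _).compl_mem_codiscrete
    filter_upwards [h2] with l hl
    have : l + a / b ≠ 0 := fun h => hl (by simpa using eq_neg_of_add_eq_zero_left h)
    rw [Pi.add_apply, ← Real.log_mul (by simpa) (by simpa), ← norm_mul]
    congr 2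
    field_simp
    ring
  rw [h1, Real.circleAverage_add (circleIntegrable_const _ _ _), Real.circleAverage_const,
    circleAverage_log_norm_add_const_eq_posLog]
  have := circleIntegrable_log_norm_affine (a / b) 1
  simpa [add_comm] using this

theorem circleAverage_log_norm_affine_of_lt {a b : ℂ} (h : ‖b‖ < ‖a‖) :
    Real.circleAverage (fun l : ℂ => Real.log ‖a + l * b‖) 0 1 = Real.log ‖a‖ := by
  rcases eq_or_ne b 0 with rfl | hb
  · simp [Real.circleAverage_const]
  have hb' : 0 < ‖b‖ := by simpa using hb
  have ha' : 0 < ‖a‖ := hb'.trans h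
  rw [circleAverage_log_norm_affine a hb, Real.posLog_eq_log, norm_div,
    Real.log_div ha'.ne' hb'.ne']
  · ring
  · rw [abs_of_nonneg (norm_nonneg _), norm_div, le_div_iff₀ hb']
    linarith

theorem log_norm_le_circleAverage {a : ℂ} (ha : a ≠ 0) (b : ℂ) :
    Real.log ‖a‖ ≤ Real.circleAverage (fun l : ℂ => Real.log ‖a + l * b‖) 0 1 := by
  rcases eq_or_ne b 0 with rfl | hb
  · simp [Real.circleAverage_const]
  rw [circleAverage_log_norm_affine a hb]
  have h1 : Real.log ‖a / b‖ ≤ Real.posLog ‖a / b‖ := by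
    rw [Real.posLog_def]; exact le_max_right _ _
  rw [norm_div, Real.log_div (by simpa) (by simpa)] at h1
  rw [norm_div]
  linarith

theorem circleAverage_mono_sphere {f g : ℂ → ℝ} (hf : CircleIntegrable f 0 1)
    (hg : CircleIntegrable g 0 1) (h : ∀ l : ℂ, ‖l‖ = 1 → f l ≤ g l) :
    Real.circleAverage f 0 1 ≤ Real.circleAverage g 0 1 :=
  Real.circleAverage_mono hf hg (fun l hl => h l (by simpa using hl))

theorem le_circleAverage_of_forall_le {g : ℂ → ℝ} {c : ℝ} (hg : CircleIntegrable g 0 1)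
    (h : ∀ l : ℂ, ‖l‖ = 1 → c ≤ g l) : c ≤ Real.circleAverage g 0 1 := by
  have := circleAverage_mono_sphere (circleIntegrable_const c 0 1) hg h
  rwa [Real.circleAverage_const] at this

theorem circleIntegrable_of_continuousOn {g : ℂ → ℝ}
    (hg : ContinuousOn g (Metric.sphere 0 1)) : CircleIntegrable g 0 1 :=
  hg.circleIntegrable zero_le_one

/-! ### Continuous functions with the sub-mean value property -/

section Submean

variable {E : Type*} [NormedAddCommGroup E] [NormedSpace ℂ E]

/-- Continuous real functions with the sub-mean value inequality on the closed discs in `U`. -/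
structure ContSubmean (f : E → ℝ) (U : Set E) : Prop where
  continuousOn : ContinuousOn f U
  submean : ∀ a b : E, (∀ l : ℂ, ‖l‖ ≤ 1 → a + l • b ∈ U) →
    f a ≤ Real.circleAverage (fun l : ℂ => f (a + l • b)) 0 1

theorem continuousOn_disc {F : Type*} [TopologicalSpace F] {f : E → F} {U : Set E}
    (hf : ContinuousOn f U) {a b : E} (h : ∀ l : ℂ, ‖l‖ ≤ 1 → a + l • b ∈ U) :
    ContinuousOn (fun l : ℂ => f (a + l • b)) (Metric.sphere 0 1) := by
  refine hf.comp (by fun_prop) fun l hl => h l ?_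
  simp at hl
  exact hl.le

theorem circleIntegrable_disc {f : E → ℝ} {U : Set E} (hf : ContinuousOn f U) {a b : E}
    (h : ∀ l : ℂ, ‖l‖ ≤ 1 → a + l • b ∈ U) :
    CircleIntegrable (fun l : ℂ => f (a + l • b)) 0 1 :=
  circleIntegrable_of_continuousOn (continuousOn_disc hf h)

namespace ContSubmean

variable {f g : E → ℝ} {U : Set E}

theorem const (c : ℝ) : ContSubmean (fun _ : E => c) U :=
  ⟨continuousOn_const, fun _ _ _ => by rw [Real.circleAverage_const]⟩

theorem add (hf : ContSubmean f U) (hg : ContSubmean g U) :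
    ContSubmean (fun x => f x + g x) U := by
  refine ⟨hf.continuousOn.add hg.continuousOn, fun a b h => ?_⟩
  rw [Real.circleAverage_fun_add (circleIntegrable_disc hf.continuousOn h)
    (circleIntegrable_disc hg.continuousOn h)]
  exact add_le_add (hf.submean a b h) (hg.submean a b h)

theorem const_mul {c : ℝ} (hc : 0 ≤ c) (hf : ContSubmean f U) :
    ContSubmean (fun x => c * f x) U := by
  refine ⟨continuousOn_const.mul hf.continuousOn, fun a b h => ?_⟩
  have := Real.circleAverage_fun_smul (𝕜 := ℝ) (a := c) (f := fun l : ℂ => f (a + l • b))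
    (c := 0) (R := 1)
  simp only [smul_eq_mul] at this
  rw [this]
  exact mul_le_mul_of_nonneg_left (hf.submean a b h) hc

theorem sum {ι : Type*} (s : Finset ι) {F : ι → E → ℝ} (hF : ∀ i ∈ s, ContSubmean (F i) U) :
    ContSubmean (fun x => ∑ i ∈ s, F i x) U := by
  classical
  induction s using Finset.induction_on with
  | empty => simpa using const 0
  | insert i s hi ih =>
    simp only [Finset.sum_insert hi]
    exact (hF i (by simp)).add (ih fun j hj => hF j (by simp [hj]))

theorem sup (hf : ContSubmean f U) (hg : ContSubmean g U) :
    ContSubmean (fun x => max (f x) (g x)) U := by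
  have hc : ContinuousOn (fun x => max (f x) (g x)) U := hf.continuousOn.sup hg.continuousOn
  refine ⟨hc, fun a b h => max_le ?_ ?_⟩
  · exact (hf.submean a b h).trans (circleAverage_mono_sphere
      (circleIntegrable_disc hf.continuousOn h) (circleIntegrable_disc hc h)
      fun l _ => le_max_left _ _)
  · exact (hg.submean a b h).trans (circleAverage_mono_sphere
      (circleIntegrable_disc hg.continuousOn h) (circleIntegrable_disc hc h)
      fun l _ => le_max_right _ _)

/-- Suprema of families inherit the submean inequality once their continuity is known; this serves
suprema of infinitely many linear forms. -/
theorem of_approx (hf : ContinuousOn f U)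
    (h : ∀ x ∈ U, ∀ y < f x, ∃ g, ContSubmean g U ∧ (∀ z ∈ U, g z ≤ f z) ∧ y ≤ g x) :
    ContSubmean f U := by
  refine ⟨hf, fun a b hab => le_of_forall_lt fun y hy => ?_⟩
  obtain ⟨y', hy', hy''⟩ := exists_between hy
  obtain ⟨g, hg, hgf, hyg⟩ := h a (by simpa using hab 0 (by simp)) y' hy''
  exact hy'.trans_le (hyg.trans ((hg.submean a b hab).trans (circleAverage_mono_sphere
    (circleIntegrable_disc hg.continuousOn hab) (circleIntegrable_disc hf hab)
    fun l hl => hgf _ (hab l hl.le))))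

theorem log_max_norm (φ : E →L[ℂ] ℂ) {ε : ℝ} (hε : 0 < ε) :
    ContSubmean (fun x => Real.log (max ‖φ x‖ ε)) U := by
  have hc : Continuous fun x => Real.log (max ‖φ x‖ ε) :=
    Continuous.log (by fun_prop) fun x => (hε.trans_le (le_max_right _ _)).ne'
  refine ⟨hc.continuousOn, fun a b h => ?_⟩
  have hi := circleIntegrable_disc hc.continuousOn h
  rcases le_total ‖φ a‖ ε with h1 | h1
  · rw [max_eq_right h1]
    exact le_circleAverage_of_forall_le hi fun l _ => Real.log_le_log hε (le_max_right _ _)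
  · rw [max_eq_left h1]
    have ha : φ a ≠ 0 := norm_pos_iff.1 (hε.trans_le h1)
    refine (log_norm_le_circleAverage ha (φ b)).trans ?_
    have key : ∀ l : ℂ, φ a + l * φ b ≠ 0 →
        Real.log ‖φ a + l * φ b‖ ≤ Real.log (max ‖φ (a + l • b)‖ ε) := fun l h0 => by
      have : φ (a + l • b) = φ a + l * φ b := by simp
      rw [this]
      exact Real.log_le_log (by simpa using h0) (le_max_left _ _)
    rcases eq_or_ne (φ b) 0 with hb | hb
    · refine circleAverage_mono_sphere (circleIntegrable_log_norm_affine _ _) hi fun l _ => key l ?_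
      simpa [hb] using ha
    -- Since `Real.log 0 = 0`, the comparison `key` can fail at the zero of the affine function. `G`
    -- enforces it everywhere and changes the integrand at one point only.
    set G : ℂ → ℝ := fun l => min (Real.log ‖φ a + l * φ b‖) (Real.log (max ‖φ (a + l • b)‖ ε))
      with hG
    have hcod : (fun l : ℂ => Real.log ‖φ a + l * φ b‖)
        =ᶠ[codiscreteWithin (Metric.sphere (0 : ℂ) |1|)] G := by
      have h2 : ({-(φ a / φ b)} : Set ℂ)ᶜ ∈ codiscreteWithin (Metric.sphere (0 : ℂ) |1|) :=
        Filter.codiscreteWithin_mono (subset_univ _) (Set.finite_singleton _).compl_mem_codiscrete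
      filter_upwards [h2] with l hl
      refine (min_eq_left (key l fun h0 => hl ?_)).symm
      simp only [mem_singleton_iff]
      field_simp
      linear_combination h0
    rw [Real.circleAverage_congr_codiscreteWithin hcod one_ne_zero]
    exact circleAverage_mono_sphere
      ((circleIntegrable_log_norm_affine _ _).congr_codiscreteWithin hcod) hi
      fun l _ => min_le_right _ _

/-- An affine function without zeros on the closed disc has ‖φ b‖ < ‖φ a‖, so the mean value
property holds with equality. Hence `c` may have either sign, as the slopes in log|ζ| require. -/
theorem log_norm_of_ne_zero (φ : E →L[ℂ] ℂ) (c : ℝ) (hφ : ∀ x ∈ U, φ x ≠ 0) :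
    ContSubmean (fun x => c * Real.log ‖φ x‖) U := by
  have hc : ContinuousOn (fun x => c * Real.log ‖φ x‖) U :=
    continuousOn_const.mul (ContinuousOn.log (by fun_prop) fun x hx => by simpa using hφ x hx)
  refine ⟨hc, fun a b h => ?_⟩
  have h1 : ‖φ b‖ < ‖φ a‖ := by
    by_contra! h1
    have ha : φ a ≠ 0 := hφ a (by simpa using h 0 (by simp))
    have hb : φ b ≠ 0 := norm_pos_iff.1 ((norm_pos_iff.2 ha).trans_le h1)
    refine hφ _ (h (-(φ a / φ b)) ?_) ?_
    · rw [norm_neg, norm_div]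
      exact div_le_one_of_le₀ h1 (norm_nonneg _)
    · simp [hb]
  have h2 := Real.circleAverage_fun_smul (𝕜 := ℝ) (a := c)
    (f := fun l : ℂ => Real.log ‖φ a + l * φ b‖) (c := 0) (R := 1)
  simp only [smul_eq_mul] at h2
  simp only [map_add, map_smul, smul_eq_mul]
  rw [h2, circleAverage_log_norm_affine_of_lt h1]

end ContSubmean

theorem tendsto_max_iInf_toReal {x : ℕ → ℝ} (hx : Antitone x) (N : ℝ) :
    Tendsto (fun k => max (x k) N) atTop
      (𝓝 (max (⨅ k, (x k : EReal)) (N : EReal)).toReal) := by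
  have h1 : Tendsto (fun k => (x k : EReal)) atTop (𝓝 (⨅ k, (x k : EReal))) :=
    tendsto_atTop_iInf fun i j h => EReal.coe_le_coe_iff.2 (hx h)
  have h2 : Tendsto (fun k => max (x k : EReal) (N : EReal)) atTop
      (𝓝 (max (⨅ k, (x k : EReal)) (N : EReal))) := h1.max tendsto_const_nhds
  have h3 : max (⨅ k, (x k : EReal)) (N : EReal) ≠ ⊤ :=
    (max_lt ((iInf_le (fun k => (x k : EReal)) 0).trans_lt (EReal.coe_lt_top _))
      (EReal.coe_lt_top N)).ne
  have h4 : max (⨅ k, (x k : EReal)) (N : EReal) ≠ ⊥ :=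
    ((EReal.bot_lt_coe N).trans_le (le_max_right _ _)).ne'
  refine ((EReal.tendsto_toReal h3 h4).comp h2).congr fun k => ?_
  simp only [Function.comp]
  rw [← EReal.coe_strictMono.monotone.map_max, EReal.toReal_coe]

/-- Decreasing limits: the truncations at `N` are bounded below by `N` and above by the truncation
of `G 0`, so dominated convergence passes the inequality to the infimum. -/
theorem isPlurisubharmonicOn_iInf {G : ℕ → E → ℝ} {U : Set E} (hG : ∀ k, ContSubmean (G k) U)
    (hanti : ∀ x ∈ U, Antitone fun k => G k x) :
    IsPlurisubharmonicOn (fun x => ⨅ k, (G k x : EReal)) U where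
  lt_top z _ := (iInf_le _ 0).trans_lt (EReal.coe_lt_top _)
  upperSemicontinuousOn := upperSemicontinuousOn_iInf fun k =>
    (continuous_coe_real_ereal.comp_continuousOn (hG k).continuousOn).upperSemicontinuousOn
  submean a b h N := by
    have hc : ∀ k, ContinuousOn (fun x => max (G k x) N) U := fun k =>
      (hG k).continuousOn.sup continuousOn_const
    have hs : ∀ θ : ℝ, a + circleMap 0 1 θ • b ∈ U := fun θ => h _ (by simp)
    have hcm : ∀ k, Continuous fun θ : ℝ => max (G k (a + circleMap 0 1 θ • b)) N := fun k =>
      (hc k).comp_continuous (by fun_prop) hs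
    have hlim : Tendsto (fun k => Real.circleAverage (fun l : ℂ => max (G k (a + l • b)) N) 0 1)
        atTop (𝓝 (Real.circleAverage
          (fun l : ℂ => (max (⨅ k, (G k (a + l • b) : EReal)) (N : EReal)).toReal) 0 1)) := by
      unfold Real.circleAverage
      refine Tendsto.const_smul ?_ _
      refine intervalIntegral.tendsto_integral_filter_of_dominated_convergence
        (fun θ => |max (G 0 (a + circleMap 0 1 θ • b)) N| + |N|) ?_ ?_ ?_ ?_
      · exact Eventually.of_forall fun k => (hcm k).aestronglyMeasurable
      · refine Eventually.of_forall fun k => Eventually.of_forall fun θ _ => ?_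
        have h1 : G k (a + circleMap 0 1 θ • b) ≤ G 0 (a + circleMap 0 1 θ • b) :=
          hanti _ (hs θ) (Nat.zero_le k)
        rw [Real.norm_eq_abs]
        refine abs_le.2 ⟨?_, ?_⟩
        · linarith [neg_abs_le N, le_max_right (G k (a + circleMap 0 1 θ • b)) N,
            abs_nonneg (max (G 0 (a + circleMap 0 1 θ • b)) N)]
        · linarith [le_abs_self (max (G 0 (a + circleMap 0 1 θ • b)) N), abs_nonneg N,
            max_le_max_right N h1]
      · exact (((hcm 0).abs).add continuous_const).intervalIntegrable _ _
      · exact Eventually.of_forall fun θ _ => tendsto_max_iInf_toReal (hanti _ (hs θ)) N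
    have h0 : a ∈ U := by simpa using h 0 (by simp)
    refine le_of_tendsto_of_tendsto
      (tendsto_atTop_iInf fun i j hij => EReal.coe_le_coe_iff.2 (hanti a h0 hij))
      (continuous_coe_real_ereal.continuousAt.tendsto.comp hlim)
      (Eventually.of_forall fun k => EReal.coe_le_coe_iff.2 ?_)
    exact ((hG k).submean a b h).trans (circleAverage_mono_sphere
      (circleIntegrable_disc (hG k).continuousOn h) (circleIntegrable_disc (hc k) h)
      fun l _ => le_max_left _ _)

namespace IsPlurisubharmonicOn

variable {u : E → EReal} {U : Set E}

theorem mono {V : Set E} (hu : IsPlurisubharmonicOn u U) (h : V ⊆ U) :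
    IsPlurisubharmonicOn u V :=
  ⟨fun z hz => hu.lt_top z (h hz), hu.upperSemicontinuousOn.mono h,
    fun a b hab => hu.submean a b fun l hl => h (hab l hl)⟩

theorem comp_affine {F : Type*} [NormedAddCommGroup F] [NormedSpace ℂ F]
    (hu : IsPlurisubharmonicOn u U) (L : F →L[ℂ] E) (c : E) {V : Set F}
    (h : ∀ x ∈ V, c + L x ∈ U) : IsPlurisubharmonicOn (fun x => u (c + L x)) V where
  lt_top z hz := hu.lt_top _ (h z hz)
  upperSemicontinuousOn := hu.upperSemicontinuousOn.comp (by fun_prop) h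
  submean a b hab N := by
    have := hu.submean (c + L a) (L b) (fun l hl => by
      simpa [add_assoc] using h _ (hab l hl)) N
    simpa [add_assoc] using this

/-- With `N` a lower bound of `g` on the circle, the truncation of `u` is still at most `g`. Upper
semicontinuity supplies the measurability needed to compare the averages. -/
theorem le_circleAverage_of_le (hu : IsPlurisubharmonicOn u U) {a b : E}
    (h : ∀ l : ℂ, ‖l‖ ≤ 1 → a + l • b ∈ U) {g : ℂ → ℝ} (hg : ContinuousOn g (Metric.sphere 0 1))
    (hle : ∀ l : ℂ, ‖l‖ = 1 → u (a + l • b) ≤ g l) :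
    u a ≤ ((Real.circleAverage g 0 1 : ℝ) : EReal) := by
  obtain ⟨N, hN⟩ : ∃ N : ℝ, ∀ l : ℂ, ‖l‖ = 1 → N ≤ g l := by
    obtain ⟨N, hN⟩ := ((isCompact_sphere (0 : ℂ) 1).image_of_continuousOn hg).bddBelow
    exact ⟨N, fun l hl => hN ⟨l, by simpa using hl, rfl⟩⟩
  obtain ⟨M, hM⟩ : ∃ M : ℝ, ∀ l : ℂ, ‖l‖ = 1 → g l ≤ M := by
    obtain ⟨M, hM⟩ := ((isCompact_sphere (0 : ℂ) 1).image_of_continuousOn hg).bddAbove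
    exact ⟨M, fun l hl => hM ⟨l, by simpa using hl, rfl⟩⟩
  have hf1 : ∀ l : ℂ, ‖l‖ = 1 → (max (u (a + l • b)) (N : EReal)).toReal ≤ g l := fun l hl => by
    have h1 : max (u (a + l • b)) (N : EReal) ≤ g l :=
      max_le (hle l hl) (EReal.coe_le_coe_iff.2 (hN l hl))
    have := EReal.toReal_le_toReal h1
      (((EReal.bot_lt_coe N).trans_le (le_max_right _ _)).ne') (EReal.coe_ne_top _)
    simpa using this
  have hf2 : ∀ l : ℂ, ‖l‖ = 1 → N ≤ (max (u (a + l • b)) (N : EReal)).toReal := fun l hl => by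
    have h1 : max (u (a + l • b)) (N : EReal) ≠ ⊤ :=
      ((max_le (hle l hl) (EReal.coe_le_coe_iff.2 (hN l hl))).trans_lt (EReal.coe_lt_top _)).ne
    have := EReal.toReal_le_toReal (le_max_right (u (a + l • b)) (N : EReal))
      (EReal.coe_ne_bot _) h1
    simpa using this
  refine (hu.submean a b h N).trans (EReal.coe_le_coe_iff.2 (circleAverage_mono_sphere ?_
    (circleIntegrable_of_continuousOn hg) hf1))
  have husc : UpperSemicontinuous fun θ : ℝ => u (a + circleMap 0 1 θ • b) := by
    rw [← upperSemicontinuousOn_univ_iff]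
    exact hu.upperSemicontinuousOn.comp (by fun_prop) fun θ _ => h _ (by simp)
  have hmeas : Measurable fun θ : ℝ =>
      (max (u (a + circleMap 0 1 θ • b)) (N : EReal)).toReal :=
    measurable_ereal_toReal.comp (husc.measurable.max measurable_const)
  refine (intervalIntegrable_const (c := |N| + |M|)).mono_fun hmeas.aestronglyMeasurable
    (Eventually.of_forall fun θ => ?_)
  have h1 : ‖circleMap 0 1 θ‖ = 1 := by simp
  simp only [Real.norm_eq_abs]
  rw [abs_of_nonneg (add_nonneg (abs_nonneg N) (abs_nonneg M))]
  refine abs_le.2 ⟨?_, ?_⟩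
  · linarith [hf2 _ h1, neg_abs_le N, abs_nonneg M]
  · linarith [hf1 _ h1, hM _ h1, le_abs_self M, abs_nonneg N]

end IsPlurisubharmonicOn
end Submean

/-! ### The three tori theorem -/

section ThreeTori

variable {ι : Type*}

/-- The coordinatewise logarithm of the modulus. -/
noncomputable def logAbs (z : ι → ℂ) : ι → ℝ := fun i => Real.log ‖z i‖

/-- The points off the coordinate hyperplanes whose logarithmic modulus lies in `S`. -/
def torusPart (S : Set (ι → ℝ)) : Set (ι → ℂ) := {z | (∀ i, z i ≠ 0) ∧ logAbs z ∈ S}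

theorem isCompact_torusPart {S : Set (ι → ℝ)} (hS : IsCompact S) : IsCompact (torusPart S) := by
  have h : torusPart S = (fun x : (ι → ℝ) × (ι → ℂ) => fun i => ((Real.exp (x.1 i) : ℝ) : ℂ) * x.2 i)
      '' (S ×ˢ Set.pi univ fun _ => Metric.sphere (0 : ℂ) 1) := by
    ext z
    constructor
    · rintro ⟨h0, h1⟩
      refine ⟨(logAbs z, fun i => z i / ‖z i‖), ⟨h1, fun i _ => ?_⟩, ?_⟩
      · simp [h0 i]
      · ext i
        have : ((‖z i‖ : ℝ) : ℂ) ≠ 0 := by simpa using h0 i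
        simp only [logAbs]
        rw [Real.exp_log (by simpa using h0 i)]
        field_simp
    · rintro ⟨⟨s, w⟩, ⟨hs, hw⟩, rfl⟩
      have hw1 : ∀ i, ‖w i‖ = 1 := fun i => by simpa using hw i (mem_univ i)
      have hn : ∀ i, ‖((Real.exp (s i) : ℝ) : ℂ) * w i‖ = Real.exp (s i) := fun i => by
        rw [norm_mul, hw1, Complex.norm_real, Real.norm_of_nonneg (Real.exp_pos _).le, mul_one]
      refine ⟨fun i => norm_pos_iff.1 (by simpa only [hn] using Real.exp_pos _), ?_⟩
      convert hs using 1
      ext i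
      simp only [logAbs, hn, Real.log_exp]
  rw [h]
  exact (hS.prod (isCompact_univ_pi fun _ => isCompact_sphere _ _)).image (by fun_prop)

theorem continuousOn_logAbs (S : Set (ι → ℝ)) : ContinuousOn logAbs (torusPart S) :=
  continuousOn_pi.2 fun i => ContinuousOn.log (by fun_prop) fun z hz => by simpa using hz.1 i

variable [Fintype ι]

/-! ### Discs in logarithmic coordinates -/

theorem abs_log_norm_one_add_sub_re_le {w : ℂ} (hw : ‖w‖ ≤ 1 / 2) :
    |Real.log ‖1 + w‖ - w.re| ≤ ‖w‖ ^ 2 := by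
  have h1 := Complex.norm_log_one_add_sub_self_le (z := w) (by linarith)
  have h2 : Real.log ‖1 + w‖ - w.re = (Complex.log (1 + w) - w).re := by
    simp [Complex.log_re]
  rw [h2]
  refine (Complex.abs_re_le_norm _).trans (h1.trans ?_)
  have h3 : (1 - ‖w‖)⁻¹ ≤ 2 := by
    rw [inv_le_comm₀ (by linarith) (by norm_num)]
    linarith
  nlinarith [sq_nonneg ‖w‖]

/-- Displacement of `logAbs` along the disc `l ↦ z (1 + l r d)`. -/
noncomputable def logDisc (d : ι → ℝ) (r : ℝ) (l : ℂ) : ι → ℝ := fun i => Real.log ‖1 + l * ((r * d i : ℝ) : ℂ)‖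

theorem norm_disc_arg_le {d : ι → ℝ} {r : ℝ} (hr : 0 ≤ r) {l : ℂ} (hl : ‖l‖ ≤ 1) (i : ι) :
    ‖l * ((r * d i : ℝ) : ℂ)‖ ≤ r * ‖d‖ := by
  rw [norm_mul, Complex.norm_real, norm_mul, Real.norm_of_nonneg hr]
  have := norm_le_pi_norm d i
  calc ‖l‖ * (r * ‖d i‖) ≤ 1 * (r * ‖d i‖) := by gcongr
    _ ≤ r * ‖d‖ := by rw [one_mul]; gcongr

theorem one_add_ne_zero_of_norm_le {w : ℂ} (hw : ‖w‖ ≤ 1 / 2) : 1 + w ≠ 0 := fun h => by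
  have : w = -1 := by linear_combination h
  rw [this] at hw
  norm_num at hw

theorem norm_logDisc_sub_le {d : ι → ℝ} {r : ℝ} (hr : 0 ≤ r) (hrd : r * ‖d‖ ≤ 1 / 2) {l : ℂ}
    (hl : ‖l‖ ≤ 1) : ‖logDisc d r l - (r * l.re) • d‖ ≤ (r * ‖d‖) ^ 2 := by
  refine (pi_norm_le_iff_of_nonneg (by positivity)).2 fun i => ?_
  have h1 := norm_disc_arg_le (d := d) hr hl i
  have h2 := abs_log_norm_one_add_sub_re_le (h1.trans hrd)
  have h3 : (l * ((r * d i : ℝ) : ℂ)).re = r * l.re * d i := by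
    rw [Complex.re_mul_ofReal]; ring
  rw [h3] at h2
  simp only [logDisc, Pi.sub_apply, Pi.smul_apply, smul_eq_mul, Real.norm_eq_abs]
  refine h2.trans ?_
  gcongr

theorem continuousOn_logDisc {d : ι → ℝ} {r : ℝ} (hr : 0 ≤ r) (hrd : r * ‖d‖ ≤ 1 / 2) :
    ContinuousOn (logDisc d r) (Metric.sphere 0 1) := by
  refine continuousOn_pi.2 fun i => ContinuousOn.log (by fun_prop) fun l hl => ?_
  have hl' : ‖l‖ ≤ 1 := by simp at hl; exact hl.le
  simpa using one_add_ne_zero_of_norm_le ((norm_disc_arg_le (d := d) hr hl' i).trans hrd)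

/-- Each coordinate is the logarithm of the modulus of a zero-free affine function equal to 1 at the
centre, so its mean is log 1 = 0. -/
theorem circleAverage_linear_logDisc {d : ι → ℝ} {r : ℝ} (hr : 0 ≤ r) (hrd : r * ‖d‖ ≤ 1 / 2)
    (ℓ : (ι → ℝ) →L[ℝ] ℝ) :
    Real.circleAverage (fun l : ℂ => ℓ (logDisc d r l)) 0 1 = 0 := by
  have hci : CircleIntegrable (logDisc d r) 0 1 :=
    (continuousOn_logDisc hr hrd).circleIntegrable zero_le_one
  have := ℓ.circleAverage_comp_comm hci
  change Real.circleAverage (ℓ ∘ logDisc d r) 0 1 = 0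
  rw [this]
  have h0 : Real.circleAverage (logDisc d r) 0 1 = 0 := by
    ext i
    have h1 := (ContinuousLinearMap.proj (R := ℝ) (φ := fun _ : ι => ℝ) i).circleAverage_comp_comm
      hci
    simp only [ContinuousLinearMap.proj_apply] at h1
    rw [← h1, Pi.zero_apply]
    have h2 := circleAverage_log_norm_affine_of_lt (a := 1) (b := ((r * d i : ℝ) : ℂ)) (by
      have := norm_disc_arg_le (d := d) hr (l := 1) (by simp) i
      rw [one_mul] at this
      rw [norm_one]
      linarith)
    simp only [norm_one, Real.log_one] at h2
    exact h2
  rw [h0, map_zero]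

theorem circleAverage_re_sq : Real.circleAverage (fun l : ℂ => l.re ^ 2) 0 1 = 1 / 2 := by
  rw [Real.circleAverage_def]
  simp only [circleMap_zero, Complex.ofReal_one, one_mul, Complex.exp_ofReal_mul_I_re]
  rw [integral_cos_sq]
  simp
  field_simp

/-- The disc moves by r Re(l) d up to an error of order r². The forms `Q i` vanish on `d`, so their
squares contribute only order r⁴, against the term -εr²/4 coming from `τ`. The linear part averages
to zero, so the radius does not depend on `ℓ`; this matters because `ℓ` will depend on the maximum
point. -/
theorem exists_circleAverage_quadratic_neg {d : ι → ℝ} {τ : (ι → ℝ) →L[ℝ] ℝ}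
    {Q : ι → (ι → ℝ) →L[ℝ] ℝ} (hτ : τ d = 1) (hQ : ∀ i, Q i d = 0) {ε C : ℝ} (hε : 0 < ε)
    (hC : 0 ≤ C) : ∃ r₀ > 0, r₀ * ‖d‖ ≤ 1 / 2 ∧ ∀ r, 0 < r → r ≤ r₀ → ∀ ℓ : (ι → ℝ) →L[ℝ] ℝ,
      Real.circleAverage (fun l : ℂ => ℓ (logDisc d r l) +
        (-ε * τ (logDisc d r l) ^ 2 + C * ∑ i, Q i (logDisc d r l) ^ 2)) 0 1 < 0 := by
  set K : ℝ := (ε * ‖τ‖ ^ 2 + C * ∑ i, ‖Q i‖ ^ 2) * ‖d‖ ^ 4 with hK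
  have hK0 : 0 ≤ K := by positivity
  have hpos : 0 < ε / (8 * (K + 1)) := by positivity
  refine ⟨min (1 / (2 * (‖d‖ + 1))) (min 1 (ε / (8 * (K + 1)))), by positivity, ?_, ?_⟩
  · calc _ ≤ 1 / (2 * (‖d‖ + 1)) * ‖d‖ := by gcongr; exact min_le_left _ _
      _ ≤ 1 / 2 := by
        rw [div_mul_eq_mul_div, div_le_div_iff₀ (by positivity) (by positivity)]
        linarith [norm_nonneg d]
  intro r hr hr0 ℓ
  have hr1 : r ≤ 1 := hr0.trans ((min_le_right _ _).trans (min_le_left _ _))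
  have hr2 : r ≤ ε / (8 * (K + 1)) := hr0.trans ((min_le_right _ _).trans (min_le_right _ _))
  have hrd : r * ‖d‖ ≤ 1 / 2 := by
    calc r * ‖d‖ ≤ 1 / (2 * (‖d‖ + 1)) * ‖d‖ := by gcongr; exact hr0.trans (min_le_left _ _)
      _ ≤ 1 / 2 := by
        rw [div_mul_eq_mul_div, div_le_div_iff₀ (by positivity) (by positivity)]
        linarith [norm_nonneg d]
  have hcd := continuousOn_logDisc hr.le hrd
  have hcℓ : ContinuousOn (fun l : ℂ => ℓ (logDisc d r l)) (Metric.sphere 0 1) :=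
    ℓ.continuous.comp_continuousOn hcd
  have hcq : ContinuousOn (fun l : ℂ => -ε * τ (logDisc d r l) ^ 2 +
      C * ∑ i, Q i (logDisc d r l) ^ 2) (Metric.sphere 0 1) := by
    have h1 := τ.continuous.comp_continuousOn hcd
    have h2 := fun i => (Q i).continuous.comp_continuousOn hcd
    exact (continuousOn_const.mul (h1.pow 2)).add
      (continuousOn_const.mul (continuousOn_finsetSum _ fun i _ => (h2 i).pow 2))
  rw [Real.circleAverage_fun_add (circleIntegrable_of_continuousOn hcℓ)
    (circleIntegrable_of_continuousOn hcq), circleAverage_linear_logDisc hr.le hrd, zero_add]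
  have hre : ContinuousOn (fun l : ℂ => l.re ^ 2) (Metric.sphere 0 1) := by fun_prop
  have hup : Real.circleAverage (fun l : ℂ => -ε * τ (logDisc d r l) ^ 2 +
      C * ∑ i, Q i (logDisc d r l) ^ 2) 0 1 ≤
      Real.circleAverage (fun l : ℂ => (-ε * r ^ 2 / 2) • l.re ^ 2 + K * r ^ 4) 0 1 := by
    refine circleAverage_mono_sphere (circleIntegrable_of_continuousOn hcq)
      (circleIntegrable_of_continuousOn (by fun_prop)) fun l hl => ?_
    set e := logDisc d r l - (r * l.re) • d with he
    have hen : ‖e‖ ≤ (r * ‖d‖) ^ 2 := norm_logDisc_sub_le hr.le hrd hl.le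
    have hy : logDisc d r l = (r * l.re) • d + e := by rw [he]; abel
    have h1 : τ (logDisc d r l) = r * l.re + τ e := by
      rw [hy, map_add, map_smul, hτ]; simp
    have h2 : ∀ i, Q i (logDisc d r l) = Q i e := fun i => by
      rw [hy, map_add, map_smul, hQ]; simp
    have hb : ∀ A : (ι → ℝ) →L[ℝ] ℝ, (A e) ^ 2 ≤ ‖A‖ ^ 2 * (‖d‖ ^ 4 * r ^ 4) := fun A => by
      rw [← sq_abs]
      calc |A e| ^ 2 ≤ (‖A‖ * (r * ‖d‖) ^ 2) ^ 2 := by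
            gcongr
            exact (A.le_opNorm e).trans (by gcongr)
        _ = _ := by ring
    have h3 : ∑ i, Q i (logDisc d r l) ^ 2 ≤ ∑ i, ‖Q i‖ ^ 2 * (‖d‖ ^ 4 * r ^ 4) :=
      Finset.sum_le_sum fun i _ => by rw [h2]; exact hb _
    rw [← Finset.sum_mul] at h3
    have h4 := hb τ
    rw [h1, smul_eq_mul, hK]
    have h5 := mul_le_mul_of_nonneg_left h3 hC
    have h6 := mul_le_mul_of_nonneg_left h4 hε.le
    -- This encodes (x + y)² ≥ x²/2 - y² with x = r Re(l) and y = τ e.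
    have h7 : 0 ≤ ε * (r * l.re + 2 * τ e) ^ 2 := by positivity
    nlinarith
  refine hup.trans_lt ?_
  rw [Real.circleAverage_fun_add (circleIntegrable_of_continuousOn (by fun_prop))
    (circleIntegrable_const _ _ _), Real.circleAverage_const, Real.circleAverage_fun_smul,
    circleAverage_re_sq, smul_eq_mul]
  have h8 : K * r ^ 2 ≤ ε / 8 := by
    have : r ^ 2 ≤ r := by nlinarith
    have h9 : r * (8 * (K + 1)) ≤ ε := (le_div_iff₀ (by positivity)).1 hr2
    nlinarith
  nlinarith [pow_pos hr 2]

theorem upperSemicontinuousOn_trunc {X : Type*} [TopologicalSpace X] {u : X → EReal} {S : Set X}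
    (hu : UpperSemicontinuousOn u S) (ht : ∀ x ∈ S, u x < ⊤) (N : ℝ) :
    UpperSemicontinuousOn (fun x => (max (u x) (N : EReal)).toReal) S := by
  have hco : ∀ x ∈ S, (((max (u x) (N : EReal)).toReal : ℝ) : EReal) = max (u x) N :=
    fun x hx => EReal.coe_toReal (max_lt (ht x hx) (EReal.coe_lt_top N)).ne
      ((EReal.bot_lt_coe N).trans_le (le_max_right _ _)).ne'
  intro x hx y hy
  have hy' : max (u x) (N : EReal) < y := by
    rw [← hco x hx]; exact EReal.coe_lt_coe_iff.2 hy
  filter_upwards [hu x hx y ((le_max_left _ _).trans_lt hy'), self_mem_nhdsWithin] with x' h1 h2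
  rw [← EReal.coe_lt_coe_iff, hco x' h2]
  exact max_lt h1 ((le_max_right _ _).trans_lt hy')

/-- The affine disc with coordinates z_i(1 + l r d_i) has logarithmic modulus exactly `logAbs z +
logDisc d r l`. -/
theorem IsPlurisubharmonicOn.submean_torus {u : (ι → ℂ) → EReal} {U : Set (ι → ℂ)}
    (hu : IsPlurisubharmonicOn u U) {z : ι → ℂ} (hz : ∀ i, z i ≠ 0) {d : ι → ℝ} {r : ℝ}
    (hr : 0 ≤ r) (hrd : r * ‖d‖ ≤ 1 / 2)
    (hU : ∀ l : ℂ, ‖l‖ ≤ 1 → torusPart {logAbs z + logDisc d r l} ⊆ U) {g : (ι → ℝ) → ℝ}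
    (hg : Continuous g)
    (hle : ∀ l : ℂ, ‖l‖ = 1 → ∀ w ∈ torusPart {logAbs z + logDisc d r l},
      u w ≤ g (logDisc d r l)) :
    u z ≤ ((Real.circleAverage (fun l => g (logDisc d r l)) 0 1 : ℝ) : EReal) := by
  have hmem : ∀ l : ℂ, ‖l‖ ≤ 1 → (z + l • fun i => z i * ((r * d i : ℝ) : ℂ)) ∈
      torusPart {logAbs z + logDisc d r l} := fun l hl => by
    have h1 : ∀ i, (z + l • fun i => z i * ((r * d i : ℝ) : ℂ)) i =
        z i * (1 + l * ((r * d i : ℝ) : ℂ)) := fun i => by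
      simp only [Pi.add_apply, Pi.smul_apply, smul_eq_mul]; ring
    have h2 : ∀ i, 1 + l * ((r * d i : ℝ) : ℂ) ≠ 0 := fun i =>
      one_add_ne_zero_of_norm_le ((norm_disc_arg_le (d := d) hr hl i).trans hrd)
    refine ⟨fun i => ?_, ?_⟩
    · rw [h1]; exact mul_ne_zero (hz i) (h2 i)
    · rw [mem_singleton_iff]
      ext i
      simp only [logAbs, logDisc, h1, Pi.add_apply]
      rw [norm_mul, Real.log_mul (by simpa using hz i) (by simpa using h2 i)]
  refine hu.le_circleAverage_of_le (fun l hl => hU l hl (hmem l hl))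
    (hg.comp_continuousOn (continuousOn_logDisc hr hrd)) fun l hl => hle l hl _ (hmem l hl.le)

theorem tendsto_logDisc_bound {d s : ι → ℝ} {V : Set (ι → ℝ)} (hV : V ∈ 𝓝 s) :
    ∃ r₀ > 0, ∀ r, 0 < r → r ≤ r₀ → r * ‖d‖ ≤ 1 / 2 → ∀ l : ℂ, ‖l‖ ≤ 1 →
      s + logDisc d r l ∈ V := by
  obtain ⟨ρ, hρ, hρV⟩ := Metric.mem_nhds_iff.1 hV
  refine ⟨ρ / (4 * (‖d‖ + 1)), by positivity, fun r hr hr0 hrd l hl => hρV ?_⟩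
  rw [Metric.mem_ball, dist_eq_norm, add_sub_cancel_left]
  have h1 := norm_logDisc_sub_le hr.le hrd hl
  have h2 : ‖(r * l.re) • d‖ ≤ r * ‖d‖ := by
    rw [norm_smul, Real.norm_eq_abs, abs_mul, abs_of_pos hr]
    have := (Complex.abs_re_le_norm l).trans hl
    calc r * |l.re| * ‖d‖ ≤ r * 1 * ‖d‖ := by gcongr
      _ = _ := by ring
  have h3 : ‖logDisc d r l‖ ≤ ‖logDisc d r l - (r * l.re) • d‖ + ‖(r * l.re) • d‖ := by
    simpa using norm_add_le (logDisc d r l - (r * l.re) • d) ((r * l.re) • d)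
  have h4 : r * ‖d‖ ≤ ρ / 4 := by
    calc r * ‖d‖ ≤ ρ / (4 * (‖d‖ + 1)) * (‖d‖ + 1) := by gcongr; linarith
      _ = ρ / 4 := by field_simp
  have h5 : 0 ≤ r * ‖d‖ := by positivity
  nlinarith

/-- A plurisubharmonic function bounded by `α` and `β` near the tori over `p` and `q` is bounded by
the linear interpolation on the tori over the segment joining `p` and `q`. -/
theorem three_tori {u : (ι → ℂ) → EReal} {U : Set (ι → ℂ)} (hu : IsPlurisubharmonicOn u U)
    {O : Set (ι → ℝ)} (hO : IsOpen O) (hOU : torusPart O ⊆ U) {p q : ι → ℝ}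
    (hseg : segment ℝ p q ⊆ O) {α β : ℝ}
    (hα : ∀ᶠ s in 𝓝 p, ∀ z ∈ torusPart {s}, u z ≤ α)
    (hβ : ∀ᶠ s in 𝓝 q, ∀ z ∈ torusPart {s}, u z ≤ β) {t : ℝ} (ht0 : 0 ≤ t) (ht1 : t ≤ 1)
    {z : ι → ℂ} (hz : z ∈ torusPart {(1 - t) • p + t • q}) :
    u z ≤ (((1 - t) * α + t * β : ℝ) : EReal) := by
  classical
  rcases eq_or_ne p q with rfl | hpq
  · have h1 : (1 - t) • p + t • p = p := by rw [← add_smul]; simp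
    rw [h1] at hz
    have h2 := hα.self_of_nhds z hz
    have h3 := hβ.self_of_nhds z hz
    refine (le_min h2 h3).trans ?_
    rw [← EReal.coe_strictMono.monotone.map_min, EReal.coe_le_coe_iff]
    nlinarith [min_le_left α β, min_le_right α β]
  obtain ⟨i₀, hi₀⟩ : ∃ i, q i - p i ≠ 0 := by
    by_contra! h
    exact hpq (funext fun i => by linarith [h i])
  set d : ι → ℝ := q - p with hd
  let pr : ι → (ι → ℝ) →L[ℝ] ℝ := fun i => ContinuousLinearMap.proj (R := ℝ) (φ := fun _ => ℝ) i
  have hpr : ∀ i s, pr i s = s i := fun i s => rfl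
  obtain ⟨τ, hτ⟩ : ∃ τ : (ι → ℝ) →L[ℝ] ℝ, τ d = 1 := ⟨(d i₀)⁻¹ • pr i₀, by
    simp [hpr, hd, hi₀]⟩
  -- `τ` measures position along the segment and `Q` is the transverse remainder: s = τ(s) d + Q(s).
  obtain ⟨Q, hQ⟩ : ∃ Q : ι → (ι → ℝ) →L[ℝ] ℝ, ∀ i s, Q i s = s i - τ s * d i :=
    ⟨fun i => pr i - d i • τ, fun i s => by simp [hpr, mul_comm]⟩
  have hQd : ∀ i, Q i d = 0 := fun i => by rw [hQ, hτ]; ring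
  -- a compact tube around the segment
  let W : ℝ → Set (ι → ℝ) := fun ρ =>
    {s | τ (s - p) ∈ Icc (0 : ℝ) 1 ∧ ∀ i, |Q i (s - p)| ≤ ρ}
  have hWdist : ∀ ρ, 0 ≤ ρ → ∀ s ∈ W ρ, dist s (p + τ (s - p) • d) ≤ ρ := fun ρ hρ s hs => by
    rw [dist_pi_le_iff hρ]
    intro i
    have := hs.2 i
    rw [hQ] at this
    rw [Real.dist_eq]
    convert this using 2
    simp only [Pi.add_apply, Pi.smul_apply, smul_eq_mul, Pi.sub_apply]
    ring
  have hsegmem : ∀ x ∈ Icc (0 : ℝ) 1, p + x • d ∈ segment ℝ p q := fun x hx => by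
    rw [segment_eq_image']
    exact ⟨x, hx, rfl⟩
  obtain ⟨ρ, hρ, hWO, hWα, hWβ⟩ : ∃ ρ > 0, W ρ ⊆ O ∧
      (∀ s ∈ W ρ, τ (s - p) = 0 → ∀ z ∈ torusPart {s}, u z ≤ α) ∧
      (∀ s ∈ W ρ, τ (s - p) = 1 → ∀ z ∈ torusPart {s}, u z ≤ β) := by
    have hcomp : IsCompact (segment ℝ p q) := by
      rw [segment_eq_image']
      exact isCompact_Icc.image (by fun_prop)
    obtain ⟨ρ₁, hρ₁, h1⟩ := hcomp.exists_cthickening_subset_open hO hseg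
    obtain ⟨ρ₂, hρ₂, h2⟩ := Metric.eventually_nhds_iff.1 hα
    obtain ⟨ρ₃, hρ₃, h3⟩ := Metric.eventually_nhds_iff.1 hβ
    have hρ : 0 < min ρ₁ (min (ρ₂ / 2) (ρ₃ / 2)) := by positivity
    refine ⟨_, hρ, fun s hs => h1 ?_, fun s hs h0 => h2 ?_, fun s hs h0 => h3 ?_⟩
    · exact Metric.mem_cthickening_of_dist_le s _ _ _ (hsegmem _ hs.1)
        ((hWdist _ hρ.le s hs).trans (min_le_left _ _))
    · have := hWdist _ hρ.le s hs
      rw [h0, zero_smul, add_zero] at this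
      have h4 := (min_le_right ρ₁ (min (ρ₂ / 2) (ρ₃ / 2))).trans (min_le_left _ _)
      linarith
    · have := hWdist _ hρ.le s hs
      rw [h0, one_smul, hd, add_sub_cancel] at this
      have h4 := (min_le_right ρ₁ (min (ρ₂ / 2) (ρ₃ / 2))).trans (min_le_right _ _)
      linarith
  have hWc : IsCompact (W ρ) := by
    refine Metric.isCompact_of_isClosed_isBounded ?_ ?_
    · have h1 : IsClosed {s : ι → ℝ | τ (s - p) ∈ Icc (0 : ℝ) 1} :=
        isClosed_Icc.preimage (f := fun s : ι → ℝ => τ (s - p)) (by fun_prop)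
      have h2 : IsClosed {s : ι → ℝ | ∀ i, |Q i (s - p)| ≤ ρ} := by
        rw [ofPred_forall]
        exact isClosed_iInter fun i => isClosed_le (by fun_prop) continuous_const
      exact h1.inter h2
    · refine (Metric.isBounded_iff_subset_closedBall p).2 ⟨ρ + ‖d‖, fun s hs => ?_⟩
      have h1 := hWdist ρ hρ.le s hs
      have h2 : dist (p + τ (s - p) • d) p ≤ ‖d‖ := by
        rw [dist_eq_norm, add_sub_cancel_left, norm_smul, Real.norm_of_nonneg hs.1.1]
        exact mul_le_of_le_one_left (norm_nonneg _) hs.1.2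
      exact (dist_triangle _ _ _).trans (add_le_add h1 h2)
  have hSc := isCompact_torusPart hWc
  have hSU : torusPart (W ρ) ⊆ U := fun z hz => hOU ⟨hz.1, hWO hz.2⟩
  -- The truncation level lies below the barrier on the whole tube, so truncation is inactive
  -- wherever the function exceeds the barrier.
  set N : ℝ := min α β with hN
  set v : (ι → ℂ) → ℝ := fun z => (max (u z) (N : EReal)).toReal with hv
  have hvco : ∀ z ∈ U, (v z : EReal) = max (u z) N :=
    fun x hx => EReal.coe_toReal (max_lt (hu.lt_top x hx) (EReal.coe_lt_top N)).ne
      ((EReal.bot_lt_coe N).trans_le (le_max_right _ _)).ne'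
  have hvusc : UpperSemicontinuousOn v (torusPart (W ρ)) :=
    upperSemicontinuousOn_trunc (hu.upperSemicontinuousOn.mono hSU)
      (fun x hx => hu.lt_top x (hSU hx)) N
  have hvle : ∀ z ∈ U, ∀ y : ℝ, N ≤ y → u z ≤ y → v z ≤ y := fun z hz y h1 h2 => by
    rw [← EReal.coe_le_coe_iff, hvco z hz]
    exact max_le h2 (EReal.coe_le_coe_iff.2 h1)
  obtain ⟨M, hM⟩ := hvusc.bddAbove_of_isCompact hSc
  have hM' : ∀ z ∈ torusPart (W ρ), v z ≤ M := fun z hz => hM ⟨z, hz, rfl⟩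
  by_contra! hcon
  have hlog : logAbs z - p = t • d := by
    rw [show logAbs z = _ from hz.2, hd, sub_smul, smul_sub, one_smul]; abel
  have hzW : z ∈ torusPart (W ρ) := ⟨hz.1, by
    refine ⟨?_, fun i => ?_⟩
    · rw [hlog, map_smul, hτ]; simp [ht0, ht1]
    · rw [hlog, map_smul, hQd]; simp [hρ.le]⟩
  obtain ⟨γ, hγ, hγz⟩ : ∃ γ > 0, (1 - t) * α + t * β + γ ≤ v z := by
    refine ⟨v z - ((1 - t) * α + t * β), ?_, by linarith⟩
    have : ((((1 - t) * α + t * β : ℝ)) : EReal) < v z := by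
      rw [hvco z (hSU hzW)]; exact hcon.trans_le (le_max_left _ _)
    linarith [EReal.coe_lt_coe_iff.1 this]
  -- On a lateral face |Q_i| = ρ the transverse term is then at least |M| + |N| + 1, which puts the
  -- barrier above the upper bound `M`.
  set C : ℝ := (|M| + |N| + 1) / ρ ^ 2 with hC
  have hC0 : 0 ≤ C := by positivity
  -- The barrier is the linear interpolation, plus a term strictly concave along the segment, plus a
  -- transverse penalty. Its mean over small discs along `d` is below the central value, so `v - φ`
  -- cannot have an interior maximum.
  set φ : (ι → ℝ) → ℝ := fun s => α + (β - α) * τ (s - p) + γ * (τ (s - p) * (1 - τ (s - p))) +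
    C * ∑ i, Q i (s - p) ^ 2 with hφ
  have hφc : Continuous φ := by fun_prop
  have hφN : ∀ s ∈ W ρ, N + C * ∑ i, Q i (s - p) ^ 2 ≤ φ s := fun s hs => by
    have h1 := hs.1.1
    have h2 := hs.1.2
    have h3 : 0 ≤ γ * (τ (s - p) * (1 - τ (s - p))) :=
      mul_nonneg hγ.le (mul_nonneg h1 (by linarith))
    have h4 : N ≤ α + (β - α) * τ (s - p) := by
      nlinarith [min_le_left α β, min_le_right α β]
    simp only [hφ]
    linarith
  have hsum0 : ∀ s, 0 ≤ C * ∑ i, Q i (s - p) ^ 2 := fun s =>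
    mul_nonneg hC0 (Finset.sum_nonneg fun i _ => sq_nonneg _)
  obtain ⟨w, hw, hwmax⟩ := UpperSemicontinuousOn.exists_isMaxOn (f := fun z => v z + -φ (logAbs z))
    ⟨z, hzW⟩ hSc (hvusc.add
      ((hφc.comp_continuousOn (continuousOn_logAbs _)).neg.upperSemicontinuousOn))
  -- At `z` the concave term is γt(1-t) ≤ γ/4, less than the assumed excess γ. A positive maximum is
  -- impossible on the end faces, where the hypotheses on `α` and `β` apply.
  have hmpos : 0 < v w - φ (logAbs w) := by
    have h1 : v z + -φ (logAbs z) ≤ v w + -φ (logAbs w) := hwmax hzW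
    have h2 : φ (logAbs z) = α + (β - α) * t + γ * (t * (1 - t)) := by
      simp only [hφ, hlog, map_smul, hτ, hQd]; simp
    rw [h2] at h1
    nlinarith [mul_nonneg ht0 (sub_nonneg.2 ht1), sq_nonneg (t - 1 / 2)]
  set m := v w - φ (logAbs w) with hm
  have hτ0 : τ (logAbs w - p) ≠ 0 := fun h0 => by
    have h1 := hvle w (hSU hw) α (min_le_left _ _) (hWα _ hw.2 h0 w ⟨hw.1, rfl⟩)
    have h2 : φ (logAbs w) = α + C * ∑ i, Q i (logAbs w - p) ^ 2 := by
      simp only [hφ, h0]; ring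
    linarith [hsum0 (logAbs w)]
  have hτ1 : τ (logAbs w - p) ≠ 1 := fun h0 => by
    have h1 := hvle w (hSU hw) β (min_le_right _ _) (hWβ _ hw.2 h0 w ⟨hw.1, rfl⟩)
    have h2 : φ (logAbs w) = β + C * ∑ i, Q i (logAbs w - p) ^ 2 := by
      simp only [hφ, h0]; ring
    linarith [hsum0 (logAbs w)]
  have hQlt : ∀ i, |Q i (logAbs w - p)| < ρ := fun i => by
    refine lt_of_le_of_ne (hw.2.2 i) fun h0 => ?_
    have h1 := hφN _ hw.2
    have h2 : ρ ^ 2 ≤ ∑ i, Q i (logAbs w - p) ^ 2 := by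
      rw [← h0, sq_abs]
      exact Finset.single_le_sum (f := fun i => Q i (logAbs w - p) ^ 2)
        (fun i _ => sq_nonneg _) (Finset.mem_univ i)
    have h3 : |M| + |N| + 1 ≤ C * ∑ i, Q i (logAbs w - p) ^ 2 := by
      calc |M| + |N| + 1 = C * ρ ^ 2 := by rw [hC]; field_simp
        _ ≤ _ := by gcongr
    linarith [hM' w hw, le_abs_self M, neg_abs_le N]
  have hWnhds : W ρ ∈ 𝓝 (logAbs w) := by
    have h1 : ∀ᶠ s in 𝓝 (logAbs w), τ (s - p) ∈ Ioo (0 : ℝ) 1 := by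
      refine (isOpen_Ioo.preimage (f := fun s : ι → ℝ => τ (s - p)) (by fun_prop)).mem_nhds ?_
      exact ⟨lt_of_le_of_ne hw.2.1.1 (Ne.symm hτ0), lt_of_le_of_ne hw.2.1.2 hτ1⟩
    have h2 : ∀ᶠ s in 𝓝 (logAbs w), ∀ i, |Q i (s - p)| < ρ := by
      rw [eventually_all]
      exact fun i => (isOpen_lt (by fun_prop) continuous_const).mem_nhds (hQlt i)
    filter_upwards [h1, h2] with s h1 h2
    exact ⟨Ioo_subset_Icc_self h1, fun i => (h2 i).le⟩
  obtain ⟨r₁, hr₁, hr₁d, hr₁neg⟩ := exists_circleAverage_quadratic_neg hτ hQd hγ hC0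
  obtain ⟨r₂, hr₂, hr₂mem⟩ := tendsto_logDisc_bound (d := d) hWnhds
  set r := min r₁ r₂ with hr
  have hr0 : 0 < r := lt_min hr₁ hr₂
  have hrd : r * ‖d‖ ≤ 1 / 2 := (by gcongr; exact min_le_left _ _ : r * ‖d‖ ≤ r₁ * ‖d‖).trans hr₁d
  have hmem := hr₂mem r hr0 (min_le_right _ _) hrd
  have hsub : ∀ l : ℂ, ‖l‖ ≤ 1 → torusPart {logAbs w + logDisc d r l} ⊆ torusPart (W ρ) :=
    fun l hl x hx => ⟨hx.1, by rw [show logAbs x = _ from hx.2]; exact hmem l hl⟩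
  have key := hu.submean_torus hw.1 hr0.le hrd (fun l hl => (hsub l hl).trans hSU)
    (g := fun y => φ (logAbs w + y) + m) (by fun_prop) (fun l hl x hx => by
      have h1 : v x + -φ (logAbs x) ≤ v w + -φ (logAbs w) := hwmax (hsub l hl.le hx)
      have h2 : u x ≤ v x := by rw [hvco x (hSU (hsub l hl.le hx))]; exact le_max_left _ _
      refine h2.trans (EReal.coe_le_coe_iff.2 ?_)
      rw [show logAbs x = _ from hx.2] at h1
      linarith)
  set ℓ : (ι → ℝ) →L[ℝ] ℝ := (β - α + γ * (1 - 2 * τ (logAbs w - p))) • τ +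
    ∑ i, (2 * C * Q i (logAbs w - p)) • Q i with hℓ
  have hexp : ∀ y, φ (logAbs w + y) + m = v w + (ℓ y + (-γ * τ y ^ 2 + C * ∑ i, Q i y ^ 2)) := by
    intro y
    have h1 : logAbs w + y - p = (logAbs w - p) + y := by abel
    have h2 : ∑ i, (Q i (logAbs w - p) + Q i y) ^ 2 = ∑ i, Q i (logAbs w - p) ^ 2 +
        2 * ∑ i, Q i (logAbs w - p) * Q i y + ∑ i, Q i y ^ 2 := by
      rw [Finset.mul_sum, ← Finset.sum_add_distrib, ← Finset.sum_add_distrib]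
      exact Finset.sum_congr rfl fun i _ => by ring
    have h3 : ∑ i, 2 * C * Q i (logAbs w - p) * Q i y =
        2 * C * ∑ i, Q i (logAbs w - p) * Q i y := by
      rw [Finset.mul_sum]
      exact Finset.sum_congr rfl fun i _ => by ring
    simp only [hm, hφ, hℓ, h1, map_add, h2, add_apply,
      smul_apply, sum_apply, smul_eq_mul, h3]
    ring
  simp only [hexp] at key
  have hcd := continuousOn_logDisc hr0.le hrd
  have hci : CircleIntegrable (fun l => ℓ (logDisc d r l) +
      (-γ * τ (logDisc d r l) ^ 2 + C * ∑ i, Q i (logDisc d r l) ^ 2)) 0 1 :=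
    circleIntegrable_of_continuousOn (Continuous.comp_continuousOn
      (g := fun y => ℓ y + (-γ * τ y ^ 2 + C * ∑ i, Q i y ^ 2)) (by fun_prop) hcd)
  rw [Real.circleAverage_fun_add (circleIntegrable_const _ _ _) hci,
    Real.circleAverage_const] at key
  have hneg := hr₁neg r hr0 (min_le_left _ _) ℓ
  have hvw : v w ≤ v w + Real.circleAverage (fun l => ℓ (logDisc d r l) +
      (-γ * τ (logDisc d r l) ^ 2 + C * ∑ i, Q i (logDisc d r l) ^ 2)) 0 1 := by
    have h1 : N < v w := by
      have := hφN _ hw.2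
      linarith [hsum0 (logAbs w)]
    have h2 : (v w : EReal) = u w := by
      have h3 := hvco w (hSU hw)
      rcases max_choice (u w) (N : EReal) with h4 | h4
      · rw [h3, h4]
      · rw [h4] at h3
        exact absurd (EReal.coe_injective h3) h1.ne'
    rw [← EReal.coe_le_coe_iff, h2]
    exact key
  linarith

end ThreeTori

/-! ### Toric envelopes -/

section Toric

variable {n : ℕ}

theorem convex_negOrthant : Convex ℝ (negOrthant n) := fun x hx y hy a b ha hb hab i => by
  have h1 := hx i
  have h2 := hy i
  simp only [Pi.add_apply, Pi.smul_apply, smul_eq_mul]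
  rcases ha.eq_or_lt with rfl | ha
  · have : b = 1 := by linarith
    subst this; linarith
  · nlinarith

theorem isOpen_negOrthant : IsOpen (negOrthant n) := by
  have : negOrthant n = ⋂ i, {s : Fin n → ℝ | s i < 0} := by ext; simp [negOrthant]
  rw [this]
  exact isOpen_iInter_of_finite fun i => isOpen_lt (continuous_apply i) continuous_const

theorem isOpen_polydisc : IsOpen (polydisc n) := by
  have : polydisc n = ⋂ i, {s : Fin n → ℂ | ‖s i‖ < 1} := by ext; simp [polydisc]
  rw [this]
  exact isOpen_iInter_of_finite fun i => isOpen_lt (by fun_prop) continuous_const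

theorem logAbs_mem_negOrthant {z : Fin n → ℂ} (hz : z ∈ polydisc n) (h0 : ∀ i, z i ≠ 0) :
    logAbs z ∈ negOrthant n := fun i => Real.log_neg (by simpa using h0 i) (hz i)

theorem torusPart_negOrthant_subset : torusPart (negOrthant n) ⊆ polydisc n := fun z hz i =>
  (Real.log_neg_iff (by simpa using hz.1 i)).1 (hz.2 i)

def nonnegOrthant (n : ℕ) : Set (Fin n → ℝ) := {a | ∀ i, 0 ≤ a i}

def posOrthant (n : ℕ) : Set (Fin n → ℝ) := {a | ∀ i, 0 < a i}

theorem posOrthant_subset : posOrthant n ⊆ nonnegOrthant n := fun _ ha i => (ha i).le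

theorem dotProduct_nonpos {a s : Fin n → ℝ} (ha : a ∈ nonnegOrthant n) (hs : s ∈ negOrthant n) :
    a ⬝ᵥ s ≤ 0 :=
  Finset.sum_nonpos fun i _ => mul_nonpos_of_nonneg_of_nonpos (ha i) (hs i).le

theorem dotProduct_mono {a s s' : Fin n → ℝ} (ha : a ∈ nonnegOrthant n) (h : s ≤ s') :
    a ⬝ᵥ s ≤ a ⬝ᵥ s' :=
  Finset.sum_le_sum fun i _ => mul_le_mul_of_nonneg_left (h i) (ha i)

/-- The supremum of the linear forms with coefficient vectors in `P`. -/
noncomputable def supLin (P : Set (Fin n → ℝ)) (s : Fin n → ℝ) : ℝ :=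
  sSup ((fun a => a ⬝ᵥ s) '' P)

/-! ### Suprema of families of nonnegative linear forms -/

section SupLin

variable {P : Set (Fin n → ℝ)}

theorem le_supLin (hP : P ⊆ nonnegOrthant n) {a s : Fin n → ℝ} (ha : a ∈ P) (hs : s ∈ negOrthant n) :
    a ⬝ᵥ s ≤ supLin P s :=
  le_csSup ⟨0, by rintro _ ⟨b, hb, rfl⟩; exact dotProduct_nonpos (hP hb) hs⟩ ⟨a, ha, rfl⟩

theorem supLin_nonpos (hP : P ⊆ nonnegOrthant n) {s : Fin n → ℝ} (hs : s ∈ negOrthant n) : supLin P s ≤ 0 :=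
  Real.sSup_nonpos (by rintro _ ⟨b, hb, rfl⟩; exact dotProduct_nonpos (hP hb) hs)

theorem supLin_mono (hP : P ⊆ nonnegOrthant n) (hne : P.Nonempty) {s s' : Fin n → ℝ}
    (hs' : s' ∈ negOrthant n) (h : s ≤ s') : supLin P s ≤ supLin P s' :=
  csSup_le (hne.image _) (by
    rintro _ ⟨b, hb, rfl⟩
    exact (dotProduct_mono (hP hb) h).trans (le_supLin hP hb hs'))

theorem continuousOn_supLin (hP : P ⊆ nonnegOrthant n) (hne : P.Nonempty) :
    ContinuousOn (supLin P) (negOrthant n) := by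
  refine ConvexOn.continuousOn isOpen_negOrthant ⟨convex_negOrthant, ?_⟩
  intro x hx y hy a b ha hb hab
  refine csSup_le (hne.image _) ?_
  rintro _ ⟨c, hc, rfl⟩
  simp only [dotProduct_add, dotProduct_smul]
  exact add_le_add (mul_le_mul_of_nonneg_left (le_supLin hP hc hx) ha)
    (mul_le_mul_of_nonneg_left (le_supLin hP hc hy) hb)

end SupLin

theorem supLin_singleton (a s : Fin n → ℝ) : supLin {a} s = a ⬝ᵥ s := by
  simp [supLin]

/-- The logarithmic modulus with the coordinates bounded away from `0`. -/
noncomputable def logTrunc (k : ℕ) (z : Fin n → ℂ) : Fin n → ℝ :=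
  fun i => Real.log (max ‖z i‖ (1 / ((k : ℝ) + 2)))

theorem radius_pos (k : ℕ) : 0 < 1 / ((k : ℝ) + 2) := by positivity

theorem radius_lt_one (k : ℕ) : 1 / ((k : ℝ) + 2) < 1 := by
  rw [div_lt_one (by positivity)]
  have : (0 : ℝ) ≤ k := k.cast_nonneg
  linarith

theorem radius_anti {j k : ℕ} (h : j ≤ k) : 1 / ((k : ℝ) + 2) ≤ 1 / ((j : ℝ) + 2) := by
  gcongr

theorem tendsto_radius : Tendsto (fun k : ℕ => 1 / ((k : ℝ) + 2)) atTop (𝓝 0) := by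
  have := tendsto_one_div_add_atTop_nhds_zero_nat (𝕜 := ℝ)
  have h2 := (tendsto_add_atTop_iff_nat 1).2 this
  refine h2.congr fun k => ?_
  push_cast
  ring

theorem logTrunc_mem {z : Fin n → ℂ} (hz : z ∈ polydisc n) (k : ℕ) :
    logTrunc k z ∈ negOrthant n := fun _ =>
  Real.log_neg ((radius_pos k).trans_le (le_max_right _ _)) (max_lt (hz _) (radius_lt_one k))

theorem logTrunc_anti (z : Fin n → ℂ) : Antitone fun k => logTrunc k z := fun _ _ h _ =>
  Real.log_le_log ((radius_pos _).trans_le (le_max_right _ _))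
    (max_le_max_left _ (radius_anti h))

theorem logAbs_le_logTrunc {z : Fin n → ℂ} (h0 : ∀ i, z i ≠ 0) (k : ℕ) :
    logAbs z ≤ logTrunc k z := fun i =>
  Real.log_le_log (by simpa using h0 i) (le_max_left _ _)

theorem exists_logTrunc_eq {z : Fin n → ℂ} (h0 : ∀ i, z i ≠ 0) :
    ∃ k, logTrunc k z = logAbs z := by
  have h1 : ∀ᶠ k : ℕ in atTop, ∀ i, 1 / ((k : ℝ) + 2) < ‖z i‖ := by
    rw [eventually_all]
    exact fun i => tendsto_radius.eventually_lt_const (by simpa using h0 i)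
  obtain ⟨k, hk⟩ := h1.exists
  exact ⟨k, funext fun i => by simp only [logTrunc, logAbs, max_eq_left (hk i).le]⟩

theorem tendsto_logTrunc_of_eq_zero {z : Fin n → ℂ} {j : Fin n} (hj : z j = 0) :
    Tendsto (fun k => logTrunc k z j) atTop atBot := by
  have h1 : (fun k : ℕ => logTrunc k z j) = fun k : ℕ => Real.log (1 / ((k : ℝ) + 2)) := by
    ext k
    simp only [logTrunc, hj, norm_zero, max_eq_right (radius_pos k).le]
  rw [h1]
  exact Real.tendsto_log_nhdsGT_zero.comp (tendsto_nhdsWithin_iff.2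
    ⟨tendsto_radius, Eventually.of_forall fun k => radius_pos k⟩)

theorem continuous_logTrunc (k : ℕ) : Continuous (logTrunc (n := n) k) :=
  continuous_pi fun _ => Continuous.log (by fun_prop) fun _ =>
    ((radius_pos k).trans_le (le_max_right _ _)).ne'

/-- The upper semicontinuous extension of `max m (supLin P (logAbs z) + e)` across the coordinate
hyperplanes. -/
noncomputable def toricEnv (P : Set (Fin n → ℝ)) (m e : ℝ) (z : Fin n → ℂ) : EReal :=
  ⨅ k : ℕ, ((max m (supLin P (logTrunc k z) + e) : ℝ) : EReal)

theorem annulus_ne_zero {ζ : ℂ} (h : ζ ∈ annulus) : ζ ≠ 0 := by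
  rintro rfl
  simpa using h.1

theorem contSubmean_supLin_logTrunc {P : Set (Fin n → ℝ)} (hP : P ⊆ nonnegOrthant n)
    (hne : P.Nonempty) (k : ℕ) :
    ContSubmean (fun x : (Fin n → ℂ) × ℂ => supLin P (logTrunc k x.1))
      (polydisc n ×ˢ annulus) := by
  refine ContSubmean.of_approx ?_ fun x hx y hy => ?_
  · refine (continuousOn_supLin hP hne).comp
      ((continuous_logTrunc k).comp continuous_fst).continuousOn fun x hx => logTrunc_mem hx.1 k
  · obtain ⟨_, ⟨a, ha, rfl⟩, hya⟩ := exists_lt_of_lt_csSup (hne.image _) hy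
    refine ⟨fun x => a ⬝ᵥ logTrunc k x.1, ?_,
      fun z hz => le_supLin hP ha (logTrunc_mem hz.1 k), hya.le⟩
    refine ContSubmean.sum _ fun i _ => ContSubmean.const_mul (hP ha i) ?_
    exact ContSubmean.log_max_norm
      ((ContinuousLinearMap.proj (R := ℂ) (φ := fun _ : Fin n => ℂ) i).comp
        (ContinuousLinearMap.fst ℂ (Fin n → ℂ) ℂ)) (radius_pos k)

theorem isPlurisubharmonicOn_toricEnv_prod {P : Set (Fin n → ℝ)} (hP : P ⊆ nonnegOrthant n)
    (hne : P.Nonempty) (m₀ m₁ e₀ e₁ : ℝ) :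
    IsPlurisubharmonicOn (fun x : (Fin n → ℂ) × ℂ =>
      toricEnv P (m₀ + m₁ * Real.log ‖x.2‖) (e₀ + e₁ * Real.log ‖x.2‖) x.1)
      (polydisc n ×ˢ annulus) := by
  have hlog : ∀ c d : ℝ, ContSubmean (fun x : (Fin n → ℂ) × ℂ => c + d * Real.log ‖x.2‖)
      (polydisc n ×ˢ annulus) := fun c d =>
    (ContSubmean.const c).add (ContSubmean.log_norm_of_ne_zero
      (ContinuousLinearMap.snd ℂ (Fin n → ℂ) ℂ) d fun x hx => annulus_ne_zero hx.2)
  refine isPlurisubharmonicOn_iInf (fun k =>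
    (hlog m₀ m₁).sup ((contSubmean_supLin_logTrunc hP hne k).add (hlog e₀ e₁))) ?_
  intro x hx i j hij
  have := supLin_mono hP hne (logTrunc_mem hx.1 i) (logTrunc_anti x.1 hij)
  dsimp only
  gcongr

theorem ofReal_exp_mem_annulus {t : ℝ} (h0 : 0 < t) (h1 : t < 1) :
    ((Real.exp t : ℝ) : ℂ) ∈ annulus := by
  simp only [annulus, mem_ofPred_eq]
  rw [Complex.norm_real, Real.norm_of_nonneg (Real.exp_pos _).le, Real.log_exp]
  exact ⟨h0, h1⟩

theorem log_norm_ofReal_exp (t : ℝ) : Real.log ‖((Real.exp t : ℝ) : ℂ)‖ = t := by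
  rw [Complex.norm_real, Real.norm_of_nonneg (Real.exp_pos _).le, Real.log_exp]

theorem IsPlurisubharmonicOn.slice {u : (Fin n → ℂ) × ℂ → EReal}
    (hu : IsPlurisubharmonicOn u (polydisc n ×ˢ annulus)) {ζ : ℂ} (hζ : ζ ∈ annulus) :
    IsPlurisubharmonicOn (fun z => u (z, ζ)) (polydisc n) := by
  have := hu.comp_affine (ContinuousLinearMap.inl ℂ (Fin n → ℂ) ℂ) (0, ζ) (V := polydisc n)
    (fun z hz => by simpa using ⟨hz, hζ⟩)
  simpa using this

theorem isPlurisubharmonicOn_toricEnv {P : Set (Fin n → ℝ)} (hP : P ⊆ nonnegOrthant n)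
    (hne : P.Nonempty) (m e : ℝ) : IsPlurisubharmonicOn (toricEnv P m e) (polydisc n) := by
  have := (isPlurisubharmonicOn_toricEnv_prod hP hne m 0 e 0).slice
    (ofReal_exp_mem_annulus (t := 1 / 2) (by norm_num) (by norm_num))
  simpa using this

theorem le_toricEnv (P : Set (Fin n → ℝ)) (m e : ℝ) (z : Fin n → ℂ) :
    (m : EReal) ≤ toricEnv P m e z :=
  le_iInf fun _ => EReal.coe_le_coe_iff.2 (le_max_left _ _)

theorem toricEnv_nonpos {P : Set (Fin n → ℝ)} (hP : P ⊆ nonnegOrthant n) {m e : ℝ} (hm : m ≤ 0)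
    (he : e ≤ 0) {z : Fin n → ℂ} (hz : z ∈ polydisc n) : toricEnv P m e z ≤ 0 := by
  refine (iInf_le _ 0).trans ?_
  rw [← EReal.coe_zero, EReal.coe_le_coe_iff]
  exact max_le hm (by linarith [supLin_nonpos hP (logTrunc_mem hz 0)])

theorem le_toricEnv_of_mem {P : Set (Fin n → ℝ)} (hP : P ⊆ nonnegOrthant n) {a : Fin n → ℝ}
    (ha : a ∈ P) (m e : ℝ) {z : Fin n → ℂ} (hz : z ∈ polydisc n) (h0 : ∀ i, z i ≠ 0) :
    ((a ⬝ᵥ logAbs z + e : ℝ) : EReal) ≤ toricEnv P m e z :=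
  le_iInf fun k => EReal.coe_le_coe_iff.2 (le_max_of_le_right (by
    have h1 := dotProduct_mono (hP ha) (logAbs_le_logTrunc h0 k)
    have h2 := le_supLin hP ha (logTrunc_mem hz k)
    linarith))

/-- A form with all coefficients positive tends to -∞ at every coordinate hyperplane, so the bound
is needed only off the hyperplanes. -/
theorem toricEnv_singleton_le {a : Fin n → ℝ} (ha : a ∈ posOrthant n) {m e : ℝ}
    {z : Fin n → ℂ} (hz : z ∈ polydisc n) (h : (∀ i, z i ≠ 0) → a ⬝ᵥ logAbs z + e ≤ m) :
    toricEnv {a} m e z ≤ m := by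
  by_cases h0 : ∀ i, z i ≠ 0
  · obtain ⟨k, hk⟩ := exists_logTrunc_eq h0
    refine (iInf_le _ k).trans (EReal.coe_le_coe_iff.2 ?_)
    rw [hk, supLin_singleton, max_eq_left (h h0)]
  · push Not at h0
    obtain ⟨j, hj⟩ := h0
    obtain ⟨k, hk⟩ := ((tendsto_logTrunc_of_eq_zero hj).eventually_le_atBot ((m - e) / a j)).exists
    refine (iInf_le _ k).trans (EReal.coe_le_coe_iff.2 ?_)
    rw [supLin_singleton, max_eq_left]
    have h1 : a ⬝ᵥ logTrunc k z ≤ a j * logTrunc k z j := by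
      rw [dotProduct, ← Finset.add_sum_erase _ _ (Finset.mem_univ j)]
      have := Finset.sum_nonpos (s := Finset.univ.erase j)
        (f := fun i => a i * logTrunc k z i) fun i _ =>
          mul_nonpos_of_nonneg_of_nonpos (ha i).le (logTrunc_mem hz k i).le
      linarith
    have h2 : a j * logTrunc k z j ≤ m - e := by
      have := mul_le_mul_of_nonneg_left hk (ha j).le
      rwa [mul_div_cancel₀ _ (ha j).ne'] at this
    linarith

/-- Approximation of `z` by points off the coordinate hyperplanes. -/
noncomputable def torusApprox (k : ℕ) (z : Fin n → ℂ) : Fin n → ℂ := fun i =>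
  if 1 / ((k : ℝ) + 2) ≤ ‖z i‖ then z i else ((1 / ((k : ℝ) + 2) : ℝ) : ℂ)

theorem norm_torusApprox (k : ℕ) (z : Fin n → ℂ) (i : Fin n) :
    ‖torusApprox k z i‖ = max ‖z i‖ (1 / ((k : ℝ) + 2)) := by
  unfold torusApprox
  split_ifs with h
  · rw [max_eq_left h]
  · rw [max_eq_right (not_le.1 h).le, Complex.norm_real, Real.norm_of_nonneg (radius_pos k).le]

theorem torusApprox_ne_zero (k : ℕ) (z : Fin n → ℂ) (i : Fin n) : torusApprox k z i ≠ 0 := by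
  rw [← norm_pos_iff, norm_torusApprox]
  exact (radius_pos k).trans_le (le_max_right _ _)

theorem logAbs_torusApprox (k : ℕ) (z : Fin n → ℂ) : logAbs (torusApprox k z) = logTrunc k z :=
  funext fun i => by simp only [logAbs, logTrunc, norm_torusApprox]

theorem tendsto_torusApprox (z : Fin n → ℂ) :
    Tendsto (fun k => torusApprox k z) atTop (𝓝 z) := by
  refine tendsto_pi_nhds.2 fun i => ?_
  rcases eq_or_ne (z i) 0 with h | h
  · have h1 : ∀ k : ℕ, torusApprox k z i = ((1 / ((k : ℝ) + 2) : ℝ) : ℂ) := fun k => by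
      have := radius_pos k
      unfold torusApprox
      rw [if_neg]
      rw [h, norm_zero]
      exact not_le.2 this
    simp only [h1, h]
    rw [← Complex.ofReal_zero]
    exact (Complex.continuous_ofReal.tendsto 0).comp tendsto_radius
  · refine tendsto_const_nhds.congr' ?_
    filter_upwards [tendsto_radius.eventually_lt_const (norm_pos_iff.2 h)] with k hk
    unfold torusApprox
    rw [if_pos hk.le]

theorem le_relExtremalEnvelope {E : Type*} [NormedAddCommGroup E] [NormedSpace ℂ E] {Ω K : Set E}
    {u : E → EReal} (hu : IsPlurisubharmonicOn u Ω) (h0 : ∀ z ∈ Ω, u z ≤ 0)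
    (h1 : ∀ z ∈ K, u z ≤ -1) (y : E) : u y ≤ relExtremalEnvelope Ω K y :=
  le_sSup ⟨u, hu, h0, h1, rfl⟩

/-- Each single a in `P`, rescaled by 1/c, gives a competitor. The envelope of all of `P` need not
be one, since its supremum may stay above the floor at hyperplane points of K. At points with zero
coordinates the bound follows by approximation with `torusApprox`, because ω is defined as a limsup.
-/
theorem toricEnv_le_relExtremal {K : Set (Fin n → ℂ)} (hK : K ⊆ polydisc n) {c e : ℝ}
    (hc : 0 < c) (he : e ≤ 0) {P : Set (Fin n → ℝ)} (hP : P ⊆ posOrthant n) (hne : P.Nonempty)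
    (h : ∀ a ∈ P, ∀ z ∈ K, (∀ i, z i ≠ 0) → a ⬝ᵥ logAbs z + e ≤ -c) {z : Fin n → ℂ}
    (hz : z ∈ polydisc n) :
    toricEnv P (-c) e z ≤ (c : EReal) * relExtremal (polydisc n) K z := by
  rw [← EReal.ge_of_forall_gt_iff_ge]
  intro y hy
  have key : ((y / c : ℝ) : EReal) ≤ relExtremal (polydisc n) K z := by
    have hfreq : ∀ᶠ k in atTop, ((y / c : ℝ) : EReal) ≤
        relExtremalEnvelope (polydisc n) K (torusApprox k z) := by
      have hpd : ∀ᶠ k in atTop, torusApprox k z ∈ polydisc n :=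
        (tendsto_torusApprox z).eventually (isOpen_polydisc.mem_nhds hz)
      filter_upwards [hpd] with k hk
      have hv : ∀ a ∈ P, toricEnv {c⁻¹ • a} (-1) (e / c) (torusApprox k z) ≤
          relExtremalEnvelope (polydisc n) K (torusApprox k z) := fun a ha => by
        have hca : c⁻¹ • a ∈ posOrthant n := fun i => mul_pos (inv_pos.2 hc) (hP ha i)
        have hcs : {c⁻¹ • a} ⊆ nonnegOrthant n := singleton_subset_iff.2 (posOrthant_subset hca)
        refine le_relExtremalEnvelope
          (isPlurisubharmonicOn_toricEnv hcs (singleton_nonempty _) _ _) (fun w hw =>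
          toricEnv_nonpos hcs (by norm_num) (div_nonpos_of_nonpos_of_nonneg he hc.le) hw)
          (fun w hw => ?_) _
        have := toricEnv_singleton_le hca (m := -1) (e := e / c) (hK hw) fun h0 => by
          have h1 := h a ha w hw h0
          rw [smul_dotProduct, smul_eq_mul, inv_mul_eq_div, ← add_div, div_le_iff₀ hc]
          linarith
        simpa using this
      obtain ⟨a, ha, hya⟩ : ∃ a ∈ P, y / c ≤ max (-1) ((c⁻¹ • a) ⬝ᵥ logTrunc k z + e / c) := by
        have h2 : (y : EReal) < ((max (-c) (supLin P (logTrunc k z) + e) : ℝ) : EReal) :=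
          hy.trans_le (iInf_le _ k)
        rw [EReal.coe_lt_coe_iff, lt_max_iff] at h2
        rcases h2 with h2 | h2
        · obtain ⟨a, ha⟩ := hne
          refine ⟨a, ha, le_max_of_le_left ?_⟩
          rw [div_le_iff₀ hc]
          linarith
        · obtain ⟨_, ⟨a, ha, rfl⟩, hya⟩ := exists_lt_of_lt_csSup (hne.image _)
            (sub_lt_iff_lt_add.2 h2 : y - e < supLin P (logTrunc k z))
          refine ⟨a, ha, le_max_of_le_right ?_⟩
          rw [smul_dotProduct, smul_eq_mul, inv_mul_eq_div, ← add_div]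
          gcongr
          linarith
      refine le_trans ?_ (hv a ha)
      have hca : c⁻¹ • a ∈ nonnegOrthant n := fun i => (mul_pos (inv_pos.2 hc) (hP ha i)).le
      rcases le_max_iff.1 hya with h3 | h3
      · exact (EReal.coe_le_coe_iff.2 h3).trans (le_toricEnv _ _ _ _)
      · refine (EReal.coe_le_coe_iff.2 h3).trans ?_
        rw [← logAbs_torusApprox]
        exact le_toricEnv_of_mem (singleton_subset_iff.2 hca) (mem_singleton _) _ _ hk
          (torusApprox_ne_zero k z)
    exact le_limsup_of_frequently_le' ((tendsto_torusApprox z).frequently hfreq.frequently)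
  calc (y : EReal) = (c : EReal) * ((y / c : ℝ) : EReal) := by
        rw [← EReal.coe_mul, mul_div_cancel₀ _ hc.ne']
    _ ≤ _ := mul_le_mul_of_nonneg_left key (EReal.coe_nonneg.2 hc.le)

end Toric

/-! ### Boundary version of the three tori theorem and bounds for geodesics -/

section Boundary

variable {ι : Type*} [Fintype ι]

/-- The endpoints may lie on the boundary of `O`. The interior theorem is applied to the segment
shortened by δ at both ends, where the parameter becomes (t - δ)/(1 - 2δ), and then δ tends to 0. -/
theorem three_tori_boundary {u : (ι → ℂ) → EReal} {U : Set (ι → ℂ)}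
    (hu : IsPlurisubharmonicOn u U) {O : Set (ι → ℝ)} (hO : IsOpen O) (hOU : torusPart O ⊆ U)
    {p q : ι → ℝ} (hseg : ∀ x ∈ Ioo (0 : ℝ) 1, p + x • (q - p) ∈ O) {α β : ℝ}
    (hα : ∀ η > 0, ∀ᶠ s in 𝓝 p, s ∈ O → ∀ z ∈ torusPart {s}, u z ≤ ((α + η : ℝ) : EReal))
    (hβ : ∀ η > 0, ∀ᶠ s in 𝓝 q, s ∈ O → ∀ z ∈ torusPart {s}, u z ≤ ((β + η : ℝ) : EReal))
    {t : ℝ} (ht0 : 0 < t) (ht1 : t < 1) {z : ι → ℂ} (hz : z ∈ torusPart {p + t • (q - p)}) :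
    u z ≤ (((1 - t) * α + t * β : ℝ) : EReal) := by
  rw [← EReal.le_of_forall_lt_iff_le]
  intro y hy
  rw [EReal.coe_lt_coe_iff] at hy
  set η := y - ((1 - t) * α + t * β) with hη
  have hη0 : 0 < η := by linarith
  have hp : Tendsto (fun δ : ℝ => p + δ • (q - p)) (𝓝[>] 0) (𝓝 p) := by
    have : Continuous fun δ : ℝ => p + δ • (q - p) := by fun_prop
    simpa using (this.tendsto 0).mono_left nhdsWithin_le_nhds
  have hq : Tendsto (fun δ : ℝ => p + (1 - δ) • (q - p)) (𝓝[>] 0) (𝓝 q) := by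
    have : Continuous fun δ : ℝ => p + (1 - δ) • (q - p) := by fun_prop
    simpa using (this.tendsto 0).mono_left nhdsWithin_le_nhds
  have hlam : Tendsto (fun δ : ℝ => (1 - (t - δ) / (1 - 2 * δ)) * (α + η) +
      (t - δ) / (1 - 2 * δ) * (β + η)) (𝓝[>] 0) (𝓝 y) := by
    have : ContinuousAt (fun δ : ℝ => (1 - (t - δ) / (1 - 2 * δ)) * (α + η) +
        (t - δ) / (1 - 2 * δ) * (β + η)) 0 := by
      have h1 : ContinuousAt (fun δ : ℝ => (t - δ) / (1 - 2 * δ)) 0 :=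
        ContinuousAt.div (by fun_prop) (by fun_prop) (by norm_num)
      fun_prop
    have h2 := this.tendsto.mono_left (nhdsWithin_le_nhds (s := Ioi 0))
    convert h2 using 2
    rw [hη]
    ring
  refine ge_of_tendsto (continuous_coe_real_ereal.continuousAt.tendsto.comp hlam) ?_
  have hsmall : ∀ᶠ δ : ℝ in 𝓝[>] 0, δ < min t (1 - t) :=
    nhdsWithin_le_nhds (gt_mem_nhds (lt_min ht0 (by linarith)))
  filter_upwards [hp.eventually (hα η hη0).eventually_nhds, hq.eventually (hβ η hη0).eventually_nhds,
    hsmall, self_mem_nhdsWithin] with δ h1 h2 h3 (hδ : 0 < δ)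
  have h3t := h3.trans_le (min_le_left _ _)
  have h3t' := h3.trans_le (min_le_right _ _)
  have h4 : 0 < 1 - 2 * δ := by linarith
  have hpO : p + δ • (q - p) ∈ O := hseg δ ⟨hδ, by linarith⟩
  have hqO : p + (1 - δ) • (q - p) ∈ O := hseg (1 - δ) ⟨by linarith, by linarith⟩
  refine three_tori hu hO hOU (p := p + δ • (q - p)) (q := p + (1 - δ) • (q - p)) ?_ ?_ ?_
    (t := (t - δ) / (1 - 2 * δ)) (div_nonneg (by linarith) h4.le) ?_ ?_
  · rw [segment_eq_image']
    rintro _ ⟨x, ⟨hx0, hx1⟩, rfl⟩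
    have : p + δ • (q - p) + x • (p + (1 - δ) • (q - p) - (p + δ • (q - p))) =
        p + (δ + x * (1 - 2 * δ)) • (q - p) := by module
    dsimp only
    rw [this]
    exact hseg _ ⟨by positivity, by nlinarith⟩
  · filter_upwards [h1, hO.mem_nhds hpO] with s hs hsO using hs hsO
  · filter_upwards [h2, hO.mem_nhds hqO] with s hs hsO using hs hsO
  · rw [div_le_one h4]; linarith
  · convert hz using 3
    have h5 : (t - δ) / (1 - 2 * δ) * (1 - 2 * δ) = t - δ := div_mul_cancel₀ _ h4.ne'
    have h6 : δ + (t - δ) / (1 - 2 * δ) * (1 - 2 * δ) = t := by rw [h5]; ring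
    generalize (t - δ) / (1 - 2 * δ) = lam at h6 ⊢
    rw [← h6]
    module

end Boundary

/-! ### Upper bounds along rays and for the geodesic class -/

section GeodesicBounds

variable {n : ℕ}

/-- Interpolation along the ray from θ⁻¹s, where the bound is -κ, to the origin, where it is 0; the
point s sits at parameter 1 - θ. -/
theorem ray_bound {v : (Fin n → ℂ) → EReal} (hv : IsPlurisubharmonicOn v (polydisc n))
    (h0 : ∀ z ∈ polydisc n, v z ≤ 0) {Q : Set (Fin n → ℝ)} (hQ : IsOpen Q) {κ : ℝ}
    (hκ : ∀ z ∈ torusPart (Q ∩ negOrthant n), v z ≤ ((-κ : ℝ) : EReal)) {s : Fin n → ℝ}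
    (hs : s ∈ negOrthant n) {θ : ℝ} (hθ0 : 0 < θ) (hθ1 : θ < 1) (hsQ : θ⁻¹ • s ∈ Q)
    {z : Fin n → ℂ} (hz : z ∈ torusPart {s}) : v z ≤ ((-(θ * κ) : ℝ) : EReal) := by
  have := three_tori_boundary hv isOpen_negOrthant torusPart_negOrthant_subset
    (p := θ⁻¹ • s) (q := 0) (α := -κ) (β := 0) (t := 1 - θ) (z := z) ?_ ?_ ?_ (by linarith)
    (by linarith) ?_
  · convert this using 2
    ring
  · intro x hx i
    have h1 : (θ⁻¹ • s + x • (0 - θ⁻¹ • s)) i = (1 - x) * θ⁻¹ * s i := by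
      simp; ring
    rw [h1]
    exact mul_neg_of_pos_of_neg (mul_pos (by linarith [hx.2]) (inv_pos.2 hθ0)) (hs i)
  · intro η hη
    filter_upwards [hQ.mem_nhds hsQ] with s' hs' hsO w hw
    refine (hκ w ⟨hw.1, ?_⟩).trans (EReal.coe_le_coe_iff.2 (by linarith))
    rw [show logAbs w = s' from hw.2]
    exact ⟨hs', hsO⟩
  · intro η hη
    refine Eventually.of_forall fun s' hsO w hw => (h0 w (torusPart_negOrthant_subset
      ⟨hw.1, ?_⟩)).trans ?_
    · rw [show logAbs w = s' from hw.2]; exact hsO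
    · rw [zero_add]; exact EReal.coe_nonneg.2 hη.le
  · convert hz using 3
    rw [zero_sub, smul_neg, smul_smul, ← sub_eq_add_neg, ← sub_smul]
    have : θ⁻¹ - (1 - θ) * θ⁻¹ = 1 := by field_simp; ring
    rw [this, one_smul]

/-- Bounds pass to the hyperplanes by a disc that turns only the vanishing coordinates, at radius
1/(k+2); its boundary circle avoids all hyperplanes. -/
theorem le_of_le_on_torus {v : (Fin n → ℂ) → EReal} (hv : IsPlurisubharmonicOn v (polydisc n))
    {F : (Fin n → ℝ) → ℝ} (hF : ∀ s s', s' ∈ negOrthant n → s ≤ s' → F s ≤ F s')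
    (h : ∀ z ∈ torusPart (negOrthant n), v z ≤ F (logAbs z)) (k : ℕ) {z : Fin n → ℂ}
    (hz : z ∈ polydisc n) : v z ≤ F (logTrunc k z) := by
  have hr := radius_pos k
  have hr1 := radius_lt_one k
  set b : Fin n → ℂ := fun i => if z i = 0 then ((1 / ((k : ℝ) + 2) : ℝ) : ℂ) else 0 with hb
  have hval : ∀ (l : ℂ) (i : Fin n), ‖(z + l • b) i‖ =
      if z i = 0 then ‖l‖ * (1 / ((k : ℝ) + 2)) else ‖z i‖ := fun l i => by
    simp only [Pi.add_apply, Pi.smul_apply, smul_eq_mul, hb]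
    split_ifs with h0
    · rw [h0, zero_add, norm_mul, Complex.norm_real, Real.norm_of_nonneg hr.le]
    · simp
  have hD : ∀ l : ℂ, ‖l‖ ≤ 1 → z + l • b ∈ polydisc n := fun l hl i => by
    rw [hval]
    split_ifs with h0
    · nlinarith
    · exact hz i
  have := hv.le_circleAverage_of_le (a := z) (b := b) hD
    (g := fun _ => F (logTrunc k z)) continuousOn_const fun l hl => by
      have hne : ∀ i, (z + l • b) i ≠ 0 := fun i => by
        rw [← norm_pos_iff, hval, hl, one_mul]
        split_ifs with h0
        · exact hr
        · exact norm_pos_iff.2 h0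
      refine (h _ ⟨hne, logAbs_mem_negOrthant (hD l hl.le) hne⟩).trans
        (EReal.coe_le_coe_iff.2 (hF _ _ (logTrunc_mem hz k) fun i => ?_))
      refine Real.log_le_log (norm_pos_iff.2 (hne i)) ?_
      rw [hval, hl, one_mul]
      split_ifs with h0
      · exact le_max_right _ _
      · exact le_max_left _ _
  rwa [Real.circleAverage_const] at this

/-- The interpolation theorem in one variable, applied on the fibre {z} × A. -/
theorem geodesicClass_le_linear {u₀ u₁ : (Fin n → ℂ) → EReal} {u : (Fin n → ℂ) × ℂ → EReal}
    (hu : u ∈ geodesicClass (polydisc n) u₀ u₁) {z : Fin n → ℂ} (hz : z ∈ polydisc n) {A₀ A₁ : ℝ}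
    (h0 : u₀ z ≤ A₀) (h1 : u₁ z ≤ A₁) {ζ : ℂ} (hζ : ζ ∈ annulus) :
    u (z, ζ) ≤ (((1 - Real.log ‖ζ‖) * A₀ + Real.log ‖ζ‖ * A₁ : ℝ) : EReal) := by
  obtain ⟨hpsh, hl0, hl1⟩ := hu
  have hslice : IsPlurisubharmonicOn (fun x : Unit → ℂ => u (z, x ())) {x | x () ∈ annulus} := by
    have := hpsh.comp_affine ((ContinuousLinearMap.inr ℂ (Fin n → ℂ) ℂ).comp
      (ContinuousLinearMap.proj (R := ℂ) (φ := fun _ : Unit => ℂ) ())) (z, 0)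
      (V := {x : Unit → ℂ | x () ∈ annulus}) (fun x hx => by simpa using ⟨hz, hx⟩)
    simpa using this
  have hbd : ∀ (j : ℝ) (A : ℝ), limsup (fun ζ => u (z, ζ)) (toCircle j) ≤ A → ∀ η > 0,
      ∀ᶠ s in 𝓝 (fun _ : Unit => j), s ∈ {s : Unit → ℝ | s () ∈ Ioo (0 : ℝ) 1} →
        ∀ x ∈ torusPart {s}, u (z, x ()) ≤ ((A + η : ℝ) : EReal) := by
    intro j A hA η hη
    have h2 : limsup (fun ζ => u (z, ζ)) (toCircle j) < ((A + η : ℝ) : EReal) :=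
      hA.trans_lt (EReal.coe_lt_coe_iff.2 (by linarith))
    have h3 := eventually_lt_of_limsup_lt h2
    rw [toCircle, eventually_inf_principal, eventually_comap] at h3
    have h4 : Tendsto (fun s : Unit → ℝ => s ()) (𝓝 fun _ : Unit => j) (𝓝 j) :=
      (continuous_apply ()).tendsto _
    filter_upwards [h4.eventually h3] with s hs hsO x hx
    have h5 : Real.log ‖x ()‖ = s () := congrFun hx.2 ()
    exact (hs _ h5 (by rw [annulus, mem_ofPred_eq, h5]; exact hsO)).le
  have := three_tori_boundary hslice (O := {s : Unit → ℝ | s () ∈ Ioo (0 : ℝ) 1})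
    (isOpen_Ioo.preimage (continuous_apply ())) (fun x hx => hx.2)
    (p := fun _ => 0) (q := fun _ => 1) (α := A₀) (β := A₁) (t := Real.log ‖ζ‖)
    (z := fun _ => ζ) (fun x hx => by simpa using hx) (hbd 0 A₀ ((hl0 z hz).trans h0))
    (hbd 1 A₁ ((hl1 z hz).trans h1)) hζ.1 hζ.2
    ⟨fun _ => annulus_ne_zero hζ, by
      rw [mem_singleton_iff]; ext; simp [logAbs]⟩
  exact this

/-- Interpolation in n + 1 variables, the index `none` carrying ζ. The class controls boundary
values only pointwise in z; the fibrewise linear bound, with 0 at the opposite circle, makes them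
uniform near each endpoint. -/
theorem geodesicClass_le_of_open {u₀ u₁ : (Fin n → ℂ) → EReal} {u : (Fin n → ℂ) × ℂ → EReal}
    (hu : u ∈ geodesicClass (polydisc n) u₀ u₁) (hu₀ : ∀ z ∈ polydisc n, u₀ z ≤ 0)
    (hu₁ : ∀ z ∈ polydisc n, u₁ z ≤ 0) {Q₀ Q₁ : Set (Fin n → ℝ)} (hQ₀ : IsOpen Q₀)
    (hQ₁ : IsOpen Q₁) {κ₀ κ₁ : ℝ}
    (hκ₀ : ∀ z ∈ torusPart (Q₀ ∩ negOrthant n), u₀ z ≤ κ₀)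
    (hκ₁ : ∀ z ∈ torusPart (Q₁ ∩ negOrthant n), u₁ z ≤ κ₁) {s₀ s₁ : Fin n → ℝ}
    (hs₀ : s₀ ∈ Q₀ ∩ negOrthant n) (hs₁ : s₁ ∈ Q₁ ∩ negOrthant n) {τ : ℝ} (hτ0 : 0 < τ)
    (hτ1 : τ < 1) {z : Fin n → ℂ} (hz : z ∈ torusPart {(1 - τ) • s₀ + τ • s₁}) :
    u (z, ((Real.exp τ : ℝ) : ℂ)) ≤ (((1 - τ) * κ₀ + τ * κ₁ : ℝ) : EReal) := by
  set O : Set (Option (Fin n) → ℝ) :=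
    {s | (fun i => s (some i)) ∈ negOrthant n ∧ s none ∈ Ioo (0 : ℝ) 1} with hOdef
  have hOo : IsOpen O := (isOpen_negOrthant.preimage (f := fun (s : Option (Fin n) → ℝ) i =>
    s (some i)) (by fun_prop)).inter (isOpen_Ioo.preimage (continuous_apply none))
  set V : Set (Option (Fin n) → ℂ) :=
    {x | ((fun i => x (some i)), x none) ∈ polydisc n ×ˢ annulus} with hV
  have hpsh : IsPlurisubharmonicOn (fun x : Option (Fin n) → ℂ =>
      u ((fun i => x (some i)), x none)) V := by
    have := hu.1.comp_affine (V := V) ((ContinuousLinearMap.pi fun i : Fin n =>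
      ContinuousLinearMap.proj (R := ℂ) (φ := fun _ : Option (Fin n) => ℂ) (some i)).prod
      (ContinuousLinearMap.proj (R := ℂ) (φ := fun _ : Option (Fin n) => ℂ) none)) 0
      (fun x hx => by rw [zero_add]; exact hx)
    simpa using this
  have hOV : torusPart O ⊆ V := fun x hx =>
    ⟨torusPart_negOrthant_subset ⟨fun i => hx.1 _, hx.2.1⟩, hx.2.2⟩
  have hmem : ∀ s ∈ O, ∀ x ∈ torusPart {s}, (fun i => x (some i)) ∈ polydisc n ∧
      x none ∈ annulus ∧ Real.log ‖x none‖ = s none ∧ (∀ i, x (some i) ≠ 0) ∧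
      logAbs (fun i => x (some i)) = fun i => s (some i) := fun s hs x hx => by
    have hx2 : logAbs x = s := hx.2
    have h1 := hOV (⟨hx.1, by rw [hx2]; exact hs⟩ : x ∈ torusPart O)
    exact ⟨h1.1, h1.2, congrFun hx2 none, fun i => hx.1 _, funext fun i => congrFun hx2 (some i)⟩
  set p : Option (Fin n) → ℝ := fun o => o.elim 0 s₀ with hp
  set q : Option (Fin n) → ℝ := fun o => o.elim 1 s₁ with hq
  have := three_tori_boundary hpsh hOo hOV (p := p) (q := q) (α := κ₀) (β := κ₁) (t := τ)
    (z := fun o => o.elim ((Real.exp τ : ℝ) : ℂ) z) ?_ ?_ ?_ hτ0 hτ1 ?_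
  · exact this
  · intro x hx
    refine ⟨?_, by simpa [hp, hq] using hx⟩
    have h1 := convex_negOrthant hs₀.2 hs₁.2 (sub_nonneg.2 hx.2.le) hx.1.le (by ring)
    convert h1 using 1
    ext i
    simp [hp, hq]
    ring
  · intro η hη
    have h1 : ∀ᶠ s in 𝓝 p, (fun i => s (some i)) ∈ Q₀ :=
      (hQ₀.preimage (f := fun (s : Option (Fin n) → ℝ) i => s (some i)) (by fun_prop)).mem_nhds
        hs₀.1
    have h2 : ∀ᶠ s in 𝓝 p, (1 - s none) * κ₀ + s none * 0 < κ₀ + η :=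
      (isOpen_lt (by fun_prop) continuous_const).mem_nhds (by simpa [hp] using hη)
    filter_upwards [h1, h2] with s h1 h2 hsO x hx
    obtain ⟨hxD, hxA, hxn, hx0, hxl⟩ := hmem s hsO x hx
    have := geodesicClass_le_linear hu hxD (A₀ := κ₀) (A₁ := 0)
      (hκ₀ _ ⟨hx0, by rw [hxl]; exact ⟨h1, hsO.1⟩⟩) (hu₁ _ hxD) hxA
    refine this.trans (EReal.coe_le_coe_iff.2 ?_)
    rw [hxn]
    exact h2.le
  · intro η hη
    have h1 : ∀ᶠ s in 𝓝 q, (fun i => s (some i)) ∈ Q₁ :=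
      (hQ₁.preimage (f := fun (s : Option (Fin n) → ℝ) i => s (some i)) (by fun_prop)).mem_nhds
        hs₁.1
    have h2 : ∀ᶠ s in 𝓝 q, (1 - s none) * 0 + s none * κ₁ < κ₁ + η :=
      (isOpen_lt (by fun_prop) continuous_const).mem_nhds (by simpa [hq] using hη)
    filter_upwards [h1, h2] with s h1 h2 hsO x hx
    obtain ⟨hxD, hxA, hxn, hx0, hxl⟩ := hmem s hsO x hx
    have := geodesicClass_le_linear hu hxD (A₀ := 0) (A₁ := κ₁) (hu₀ _ hxD)
      (hκ₁ _ ⟨hx0, by rw [hxl]; exact ⟨h1, hsO.1⟩⟩) hxA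
    refine this.trans (EReal.coe_le_coe_iff.2 ?_)
    rw [hxn]
    exact h2.le
  · refine ⟨fun o => ?_, ?_⟩
    · cases o with
      | none => simp
      | some i => exact hz.1 i
    · rw [mem_singleton_iff]
      ext o
      cases o with
      | none => simp [logAbs, hp, hq]
      | some i =>
        have := congrFun (show logAbs z = _ from hz.2) i
        simp only [logAbs, Option.elim, hp, hq, Pi.add_apply, Pi.smul_apply, Pi.sub_apply,
          smul_eq_mul] at this ⊢
        rw [this]
        ring

theorem limsup_toricEnv_le {P : Set (Fin n → ℝ)} (m₀ m₁ e₀ e₁ j : ℝ) (z : Fin n → ℂ) :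
    limsup (fun ζ : ℂ => toricEnv P (m₀ + m₁ * Real.log ‖ζ‖) (e₀ + e₁ * Real.log ‖ζ‖) z)
      (toCircle j) ≤ toricEnv P (m₀ + m₁ * j) (e₀ + e₁ * j) z := by
  refine le_iInf fun k => ?_
  rw [← EReal.le_of_forall_lt_iff_le]
  intro y hy
  rw [EReal.coe_lt_coe_iff] at hy
  refine limsup_le_of_le (h := ?_)
  have h1 : ∀ᶠ x : ℝ in 𝓝 j, max (m₀ + m₁ * x) (supLin P (logTrunc k z) + (e₀ + e₁ * x)) < y :=
    (isOpen_lt (f := fun x : ℝ => max (m₀ + m₁ * x) (supLin P (logTrunc k z) + (e₀ + e₁ * x)))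
      (by fun_prop) continuous_const).mem_nhds hy
  rw [toCircle, eventually_inf_principal, eventually_comap]
  filter_upwards [h1] with x hx ζ hζ _
  refine (iInf_le _ k).trans (EReal.coe_le_coe_iff.2 ?_)
  rw [hζ]
  exact hx.le

end GeodesicBounds

/-! ### Logarithmic images -/

section LogImage

variable {n : ℕ}

/-- Non-pluripolar compact Reinhardt subsets of the polydisc that are complete logarithmically
convex. -/
structure IsAdmissible (K : Set (Fin n → ℂ)) : Prop where
  isCompact : IsCompact K
  subset : K ⊆ polydisc n
  reinhardt : IsReinhardt K
  logConvex : IsCompleteLogConvex K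
  not_pluripolar : ¬ IsPluripolar K

theorem logAbs_mem_logImage {K : Set (Fin n → ℂ)} (hD : K ⊆ polydisc n) (hR : IsReinhardt K)
    {z : Fin n → ℂ} (hz : z ∈ K) (h0 : ∀ i, z i ≠ 0) : logAbs z ∈ logImage K := by
  refine ⟨logAbs_mem_negOrthant (hD hz) h0, hR z hz _ fun i => ?_⟩
  simp only [logAbs]
  rw [Complex.norm_real, Real.norm_of_nonneg (Real.exp_pos _).le,
    Real.exp_log (by simpa using h0 i)]

theorem torusPart_logImage_subset {K : Set (Fin n → ℂ)} (hR : IsReinhardt K) :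
    torusPart (logImage K) ⊆ K := fun z hz => by
  refine hR _ hz.2.2 _ fun i => ?_
  simp only [logAbs]
  rw [Complex.norm_real, Real.norm_of_nonneg (Real.exp_pos _).le,
    Real.exp_log (by simpa using hz.1 i)]

theorem exists_logImage_le {K : Set (Fin n → ℂ)} (hK : IsCompact K) (hD : K ⊆ polydisc n) :
    ∃ δ > 0, ∀ s ∈ logImage K, ∀ i, s i ≤ -δ := by
  rcases K.eq_empty_or_nonempty with rfl | hne
  · exact ⟨1, one_pos, fun s hs => absurd hs.2 (notMem_empty _)⟩
  obtain ⟨w, hw, hmax⟩ := hK.exists_isMaxOn hne continuous_norm.continuousOn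
  have hw1 : ‖w‖ < 1 := (pi_norm_lt_iff one_pos).2 (hD hw)
  obtain ⟨r, hr0, hr1⟩ := exists_between (max_lt hw1 zero_lt_one)
  have hrpos : 0 < r := (le_max_right _ _).trans_lt hr0
  refine ⟨-Real.log r, neg_pos.2 (Real.log_neg hrpos hr1), fun s hs i => ?_⟩
  rw [neg_neg, ← Real.log_exp (s i)]
  refine Real.log_le_log (Real.exp_pos _) ?_
  have h1 : ‖fun i => ((Real.exp (s i) : ℝ) : ℂ)‖ ≤ ‖w‖ := hmax hs.2
  have h2 := norm_le_pi_norm (fun i => ((Real.exp (s i) : ℝ) : ℂ)) i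
  rw [Complex.norm_real, Real.norm_of_nonneg (Real.exp_pos _).le] at h2
  linarith [le_max_left ‖w‖ 0]

theorem isClosed_logImage {K : Set (Fin n → ℂ)} (hK : IsCompact K) (hD : K ⊆ polydisc n) :
    IsClosed (logImage K) := by
  obtain ⟨δ, hδ, h⟩ := exists_logImage_le hK hD
  have h1 : logImage K = (⋂ i, {s : Fin n → ℝ | s i ≤ -δ}) ∩
      (fun (s : Fin n → ℝ) (i : Fin n) => ((Real.exp (s i) : ℝ) : ℂ)) ⁻¹' K := by
    ext s
    refine ⟨fun hs => ⟨mem_iInter.2 (h s hs), hs.2⟩, fun hs => ⟨fun i => ?_, hs.2⟩⟩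
    have : s i ≤ -δ := mem_iInter.1 hs.1 i
    linarith
  rw [h1]
  exact (isClosed_iInter fun i => isClosed_le (continuous_apply i) continuous_const).inter
    (hK.isClosed.preimage (by fun_prop))

/-- The function Σ log|z_i| is -∞ on the coordinate hyperplanes. Thus non-pluripolarity forces Log K
to be nonempty. -/
theorem isPluripolar_of_forall_exists_eq_zero {K : Set (Fin n → ℂ)}
    (h : ∀ z ∈ K, ∃ i, z i = 0) : IsPluripolar K := by
  intro z hz
  refine ⟨univ, isOpen_univ, isConnected_univ, mem_univ z, fun z => ⨅ k : ℕ,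
    ((∑ i, logTrunc k z i : ℝ) : EReal), ?_, ?_, ?_⟩
  · refine isPlurisubharmonicOn_iInf (fun k => ContSubmean.sum _ fun i _ =>
      ContSubmean.log_max_norm (ContinuousLinearMap.proj (R := ℂ) (φ := fun _ : Fin n => ℂ) i)
        (radius_pos k)) ?_
    exact fun x _ j k hjk => Finset.sum_le_sum fun i _ => logTrunc_anti x hjk i
  · refine ⟨fun _ => 1, mem_univ _, ne_of_gt ?_⟩
    refine (EReal.bot_lt_coe 0).trans_le (le_iInf fun k => EReal.coe_le_coe_iff.2 ?_)
    exact Finset.sum_nonneg fun i _ => Real.log_nonneg (by simp)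
  · rintro w ⟨hw, -⟩
    obtain ⟨j, hj⟩ := h w hw
    rw [EReal.eq_bot_iff_forall_lt]
    intro y
    have h1 : ∀ k, ∑ i, logTrunc k w i ≤ logTrunc k w j +
        ∑ i ∈ Finset.univ.erase j, logTrunc 0 w i := fun k => by
      rw [← Finset.add_sum_erase _ _ (Finset.mem_univ j)]
      gcongr with i _
      exact logTrunc_anti w (Nat.zero_le k) i
    obtain ⟨k, hk⟩ := ((tendsto_logTrunc_of_eq_zero hj).eventually_lt_atBot
      (y - ∑ i ∈ Finset.univ.erase j, logTrunc 0 w i)).exists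
    refine (iInf_le _ k).trans_lt (EReal.coe_lt_coe_iff.2 ?_)
    linarith [h1 k]

/-- Since L absorbs the negative orthant, a Hahn–Banach functional bounded above on L has
nonnegative coefficients. Adding a small multiple of the all-ones form makes them positive: this
does not raise its values on L, which lies in the negative orthant, and barely changes the value at
s. -/
theorem exists_separating {L : Set (Fin n → ℝ)} (hcl : IsClosed L) (hcv : Convex ℝ L)
    (hadd : L + negOrthant n ⊆ L) (hL : L ⊆ negOrthant n) {s : Fin n → ℝ} (hs : s ∉ L) :
    ∃ a ∈ posOrthant n, ∃ m, (∀ x ∈ L, a ⬝ᵥ x ≤ m) ∧ m < a ⬝ᵥ s := by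
  rcases L.eq_empty_or_nonempty with rfl | ⟨x₀, hx₀⟩
  · exact ⟨fun _ => 1, fun _ => one_pos, _, fun x hx => absurd hx (notMem_empty _),
      sub_one_lt _⟩
  obtain ⟨f, u, hfL, hfs⟩ := geometric_hahn_banach_closed_point hcv hcl hs
  set a : Fin n → ℝ := fun i => f (Pi.single i 1) with ha
  have hfa : ∀ y, f y = a ⬝ᵥ y := fun y => by
    have := f.toLinearMap.pi_apply_eq_sum_univ y
    simp only [ContinuousLinearMap.coe_coe, smul_eq_mul] at this
    rw [this, dotProduct]
    refine Finset.sum_congr rfl fun i _ => ?_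
    rw [mul_comm, ha]
    congr 2
    ext j
    simp [Pi.single_apply, eq_comm]
  have hneg : ∀ y ∈ negOrthant n, f y ≤ 0 := fun y hy => by
    by_contra! hpos
    obtain ⟨r, hr⟩ := exists_nat_gt ((u - f x₀) / f y)
    have hr' : (u - f x₀) < (r + 1) * f y := by
      have := (div_lt_iff₀ hpos).1 hr
      linarith
    have hmem : x₀ + ((r : ℝ) + 1) • y ∈ L := hadd (add_mem_add hx₀ fun i =>
      mul_neg_of_pos_of_neg (by positivity) (hy i))
    have := hfL _ hmem
    rw [map_add, map_smul, smul_eq_mul] at this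
    linarith
  have ha0 : ∀ i, 0 ≤ a i := fun i => by
    have h1 : ∀ ε > 0, f (-Pi.single i 1) ≤ 0 + ε * f 1 := fun ε hε => by
      have h2 : -Pi.single i 1 - ε • (1 : Fin n → ℝ) ∈ negOrthant n := fun j => by
        have : (0 : ℝ) ≤ (Pi.single i 1 : Fin n → ℝ) j := by
          rw [Pi.single_apply]; split_ifs <;> norm_num
        simp only [Pi.sub_apply, Pi.neg_apply, Pi.smul_apply, Pi.one_apply, smul_eq_mul]
        linarith
      have h3 := hneg _ h2
      rw [map_sub, map_smul, smul_eq_mul] at h3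
      linarith
    have h2 : Tendsto (fun ε : ℝ => 0 + ε * f 1) (𝓝[>] 0) (𝓝 0) := by
      have : Continuous fun ε : ℝ => 0 + ε * f 1 := by fun_prop
      simpa using (this.tendsto 0).mono_left nhdsWithin_le_nhds
    have h3 : f (-Pi.single i 1) ≤ 0 := ge_of_tendsto h2 (by
      filter_upwards [self_mem_nhdsWithin] with ε hε using h1 ε hε)
    rw [map_neg] at h3
    linarith
  set ε : ℝ := (f s - u) / (2 * (|∑ i, s i| + 1)) with hε
  have hε0 : 0 < ε := by
    have : 0 < f s - u := by linarith
    positivity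
  have hdot : ∀ y, (a + ε • (1 : Fin n → ℝ)) ⬝ᵥ y = f y + ε * ∑ i, y i := fun y => by
    rw [add_dotProduct, smul_dotProduct, one_dotProduct, hfa, smul_eq_mul]
  refine ⟨a + ε • 1, fun i => ?_, u, fun x hx => ?_, ?_⟩
  · simp only [Pi.add_apply, Pi.smul_apply, Pi.one_apply, smul_eq_mul]
    linarith [ha0 i]
  · rw [hdot]
    have : ε * ∑ i, x i ≤ 0 := mul_nonpos_of_nonneg_of_nonpos hε0.le
      (Finset.sum_nonpos fun i _ => (hL hx i).le)
    linarith [hfL x hx]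
  · rw [hdot]
    have h1 : ε * |∑ i, s i| ≤ (f s - u) / 2 := by
      calc ε * |∑ i, s i| ≤ ε * (|∑ i, s i| + 1) := by gcongr; linarith
        _ = (f s - u) / 2 := by rw [hε]; field_simp
    have h2 : -(ε * |∑ i, s i|) ≤ ε * ∑ i, s i := by
      have := mul_le_mul_of_nonneg_left (neg_abs_le (∑ i, s i)) hε0.le
      linarith
    linarith

theorem exists_pos_dotProduct_le (hn : 1 ≤ n) {L : Set (Fin n → ℝ)} {δ : ℝ} (hδ : 0 < δ)
    (hL : ∀ s ∈ L, ∀ i, s i ≤ -δ) {c r : ℝ} (hr : c / δ ≤ r) (hr0 : 0 < r) :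
    ∀ x ∈ L, (r • (1 : Fin n → ℝ)) ⬝ᵥ x ≤ -c := fun x hx => by
  rw [smul_dotProduct, one_dotProduct, smul_eq_mul]
  have h1 : ∑ i, x i ≤ -δ := by
    have i₀ : Fin n := ⟨0, hn⟩
    rw [← Finset.add_sum_erase _ _ (Finset.mem_univ i₀)]
    have := Finset.sum_nonpos (s := Finset.univ.erase i₀) (f := x) fun i _ =>
      (hL x hx i).trans (by linarith)
    linarith [hL x hx i₀]
  have h2 : c ≤ r * δ := (div_le_iff₀ hδ).1 hr
  nlinarith

namespace IsAdmissible

variable {K : Set (Fin n → ℂ)}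

theorem isClosed (hK : IsAdmissible K) : IsClosed (logImage K) :=
  isClosed_logImage hK.isCompact hK.subset

theorem logImage_subset : logImage K ⊆ negOrthant n := fun _ hs => hs.1

theorem nonempty (hK : IsAdmissible K) : (logImage K).Nonempty := by
  by_contra hne
  rw [not_nonempty_iff_eq_empty] at hne
  refine hK.not_pluripolar (isPluripolar_of_forall_exists_eq_zero fun z hz => ?_)
  by_contra! h0
  have := logAbs_mem_logImage hK.subset hK.reinhardt hz h0
  rw [hne] at this
  exact this

theorem exists_separating (hK : IsAdmissible K) {s : Fin n → ℝ} (hs : s ∉ logImage K) :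
    ∃ a ∈ posOrthant n, ∃ m, (∀ x ∈ logImage K, a ⬝ᵥ x ≤ m) ∧ m < a ⬝ᵥ s :=
  _root_.exists_separating hK.isClosed hK.logConvex.1 hK.logConvex.2 logImage_subset hs

end IsAdmissible

end LogImage

/-! ### Relative extremal functions of admissible sets -/

section Extremal

variable {n : ℕ}

theorem relExtremal_le_of_mem_open {E : Type*} [NormedAddCommGroup E] [NormedSpace ℂ E]
    {Ω K V : Set E} (hV : IsOpen V) {z : E} (hz : z ∈ V) {f : E → EReal}
    (hf : UpperSemicontinuousOn f V) (h : ∀ y ∈ V, relExtremalEnvelope Ω K y ≤ f y) :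
    relExtremal Ω K z ≤ f z := by
  refine le_of_forall_gt fun y hy => ?_
  obtain ⟨y', h1, h2⟩ := exists_between hy
  refine lt_of_le_of_lt (limsup_le_of_le (h := ?_)) h2
  have h3 : ∀ᶠ w in 𝓝 z, f w < y' := by
    have := hf z hz y' h1
    rwa [hV.nhdsWithin_eq hz] at this
  filter_upwards [h3, hV.mem_nhds hz] with w hw hwV
  exact (h w hwV).trans hw.le

theorem relExtremal_nonpos (K : Set (Fin n → ℂ)) {z : Fin n → ℂ} (hz : z ∈ polydisc n) :
    relExtremal (polydisc n) K z ≤ 0 :=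
  relExtremal_le_of_mem_open (f := fun _ => 0) isOpen_polydisc hz
    continuousOn_const.upperSemicontinuousOn fun y hy =>
      sSup_le (by rintro _ ⟨u, -, h, -, rfl⟩; exact h y hy)

theorem isOpen_torusPart {S : Set (Fin n → ℝ)} (hS : IsOpen S) : IsOpen (torusPart S) := by
  have h1 : IsOpen {z : Fin n → ℂ | ∀ i, z i ≠ 0} := by
    rw [ofPred_forall]
    exact isOpen_iInter_of_finite fun i => isOpen_ne_fun (continuous_apply i) continuous_const
  have h2 : ContinuousOn logAbs {z : Fin n → ℂ | ∀ i, z i ≠ 0} :=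
    continuousOn_pi.2 fun i => ContinuousOn.log (by fun_prop) fun z hz => by simpa using hz i
  exact h2.isOpen_inter_preimage h1 hS

/-- The set Log K + ℝⁿ₋ is open, so the bound -1 on the unregularized envelope survives
regularization there. -/
theorem IsAdmissible.relExtremal_le_neg_one {K : Set (Fin n → ℂ)} (hK : IsAdmissible K)
    {z : Fin n → ℂ} (hz : z ∈ torusPart (logImage K + negOrthant n)) :
    relExtremal (polydisc n) K z ≤ -1 :=
  relExtremal_le_of_mem_open (f := fun _ => -1) (isOpen_torusPart isOpen_negOrthant.add_left) hz
    continuousOn_const.upperSemicontinuousOn fun y hy => sSup_le (by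
      rintro _ ⟨u, -, -, h, rfl⟩
      exact h y (torusPart_logImage_subset hK.reinhardt ⟨hy.1, hK.logConvex.2 hy.2⟩))

theorem mul_relExtremal_nonpos (K : Set (Fin n → ℂ)) {c : ℝ} (hc : 0 < c) {z : Fin n → ℂ}
    (hz : z ∈ polydisc n) : (c : EReal) * relExtremal (polydisc n) K z ≤ 0 := by
  have := mul_le_mul_of_nonneg_left (relExtremal_nonpos K hz) (EReal.coe_nonneg.2 hc.le)
  rwa [mul_zero] at this

theorem IsAdmissible.mul_relExtremal_le {K : Set (Fin n → ℂ)} (hK : IsAdmissible K) {c : ℝ}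
    (hc : 0 < c) {z : Fin n → ℂ} (hz : z ∈ torusPart (logImage K + negOrthant n)) :
    (c : EReal) * relExtremal (polydisc n) K z ≤ ((-c : ℝ) : EReal) := by
  have := mul_le_mul_of_nonneg_left (hK.relExtremal_le_neg_one hz) (EReal.coe_nonneg.2 hc.le)
  simpa using this

end Extremal

/-! ### Weighted geodesics between relative extremal functions -/

section WeightedGeodesic

variable {n : ℕ} {K₀ K₁ : Set (Fin n → ℂ)} {c₀ c₁ τ : ℝ}

theorem weight_pos (hc₀ : 0 < c₀) (hc₁ : 0 < c₁) (hτ0 : 0 < τ) (hτ1 : τ < 1) :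
    0 < (1 - τ) * c₀ + τ * c₁ :=
  add_pos (mul_pos (by linarith) hc₀) (mul_pos hτ0 hc₁)

theorem toricEnv_le_weightedGeodesic (hK₀ : IsAdmissible K₀) (hK₁ : IsAdmissible K₁)
    (hc₀ : 0 < c₀) (hc₁ : 0 < c₁) {P : Set (Fin n → ℝ)} (hP : P ⊆ posOrthant n)
    (hne : P.Nonempty) {e₀ e₁ : ℝ} (he₀ : e₀ ≤ 0) (he₁ : e₁ ≤ 0)
    (h₀ : ∀ a ∈ P, ∀ x ∈ logImage K₀, a ⬝ᵥ x + e₀ ≤ -c₀)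
    (h₁ : ∀ a ∈ P, ∀ x ∈ logImage K₁, a ⬝ᵥ x + e₁ ≤ -c₁) (z : Fin n → ℂ) :
    toricEnv P (-((1 - τ) * c₀ + τ * c₁)) ((1 - τ) * e₀ + τ * e₁) z ≤
      weightedGeodesic K₀ K₁ c₀ c₁ τ z := by
  refine le_sSup ⟨_, ⟨isPlurisubharmonicOn_toricEnv_prod (hP.trans posOrthant_subset) hne
    (-c₀) (c₀ - c₁) e₀ (e₁ - e₀), fun w hw => ?_, fun w hw => ?_⟩, ?_⟩
  · refine (limsup_toricEnv_le _ _ _ _ _ _).trans ?_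
    rw [mul_zero, mul_zero, add_zero, add_zero]
    exact toricEnv_le_relExtremal hK₀.subset hc₀ he₀ hP hne (fun a ha x hx h0 =>
      h₀ a ha _ (logAbs_mem_logImage hK₀.subset hK₀.reinhardt hx h0)) hw
  · refine (limsup_toricEnv_le _ _ _ _ _ _).trans ?_
    rw [show -c₀ + (c₀ - c₁) * 1 = -c₁ by ring, show e₀ + (e₁ - e₀) * 1 = e₁ by ring]
    exact toricEnv_le_relExtremal hK₁.subset hc₁ he₁ hP hne (fun a ha x hx h0 =>
      h₁ a ha _ (logAbs_mem_logImage hK₁.subset hK₁.reinhardt hx h0)) hw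
  · dsimp only
    rw [log_norm_ofReal_exp]
    congr 1 <;> ring

/-- Each Log K_j stays below some -δ_j, so a large multiple of the all-ones form is admissible; the
floor of its envelope is the required constant. -/
theorem neg_weight_le_weightedGeodesic (hn : 1 ≤ n) (hK₀ : IsAdmissible K₀)
    (hK₁ : IsAdmissible K₁) (hc₀ : 0 < c₀) (hc₁ : 0 < c₁) (z : Fin n → ℂ) :
    ((-((1 - τ) * c₀ + τ * c₁) : ℝ) : EReal) ≤ weightedGeodesic K₀ K₁ c₀ c₁ τ z := by
  obtain ⟨δ₀, hδ₀, h₀⟩ := exists_logImage_le hK₀.isCompact hK₀.subset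
  obtain ⟨δ₁, hδ₁, h₁⟩ := exists_logImage_le hK₁.isCompact hK₁.subset
  set r := max (c₀ / δ₀) (c₁ / δ₁) with hr
  have hr0 : 0 < r := (div_pos hc₀ hδ₀).trans_le (le_max_left _ _)
  refine (le_toricEnv {r • (1 : Fin n → ℝ)} _ ((1 - τ) * 0 + τ * 0) z).trans
    (toricEnv_le_weightedGeodesic hK₀ hK₁ hc₀ hc₁ (singleton_subset_iff.2 fun i => ?_)
      (singleton_nonempty _) le_rfl le_rfl ?_ ?_ z)
  · simpa using hr0
  · rintro _ rfl x hx
    rw [add_zero]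
    exact exists_pos_dotProduct_le hn hδ₀ h₀ (le_max_left _ _) hr0 x hx
  · rintro _ rfl x hx
    rw [add_zero]
    exact exists_pos_dotProduct_le hn hδ₁ h₁ (le_max_right _ _) hr0 x hx

theorem weightedGeodesic_le_of_open (hc₀ : 0 < c₀) (hc₁ : 0 < c₁)
    {Q₀ Q₁ : Set (Fin n → ℝ)} (hQ₀ : IsOpen Q₀) (hQ₁ : IsOpen Q₁) {κ₀ κ₁ : ℝ}
    (hκ₀ : ∀ z ∈ torusPart (Q₀ ∩ negOrthant n),
      (c₀ : EReal) * relExtremal (polydisc n) K₀ z ≤ κ₀)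
    (hκ₁ : ∀ z ∈ torusPart (Q₁ ∩ negOrthant n),
      (c₁ : EReal) * relExtremal (polydisc n) K₁ z ≤ κ₁) {s₀ s₁ : Fin n → ℝ}
    (hs₀ : s₀ ∈ Q₀ ∩ negOrthant n) (hs₁ : s₁ ∈ Q₁ ∩ negOrthant n) (hτ0 : 0 < τ) (hτ1 : τ < 1)
    {z : Fin n → ℂ} (hz : z ∈ torusPart {(1 - τ) • s₀ + τ • s₁}) :
    weightedGeodesic K₀ K₁ c₀ c₁ τ z ≤ (((1 - τ) * κ₀ + τ * κ₁ : ℝ) : EReal) :=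
  sSup_le (by
    rintro _ ⟨u, hu, rfl⟩
    exact geodesicClass_le_of_open hu (fun w hw => mul_relExtremal_nonpos K₀ hc₀ hw)
      (fun w hw => mul_relExtremal_nonpos K₁ hc₁ hw) hQ₀ hQ₁ hκ₀ hκ₁ hs₀ hs₁ hτ0 hτ1 hz)

theorem add_negOrthant_subset (hK₀ : IsAdmissible K₀) :
    logImage K₀ + negOrthant n ⊆ negOrthant n :=
  hK₀.logConvex.2.trans IsAdmissible.logImage_subset

theorem exists_mem_torusPart (s : Fin n → ℝ) : ∃ z : Fin n → ℂ, z ∈ torusPart {s} :=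
  ⟨fun i => ((Real.exp (s i) : ℝ) : ℂ), fun i => by simp, by
    rw [mem_singleton_iff]
    exact funext fun i => log_norm_ofReal_exp (s i)⟩

theorem mem_polydisc_of_torusPart {s : Fin n → ℝ} (hs : s ∈ negOrthant n) {z : Fin n → ℂ}
    (hz : z ∈ torusPart {s}) : z ∈ polydisc n :=
  torusPart_negOrthant_subset ⟨hz.1, by rw [show logAbs z = s from hz.2]; exact hs⟩

theorem weightedGeodesic_le_neg_weight (hK₀ : IsAdmissible K₀) (hK₁ : IsAdmissible K₁)
    (hc₀ : 0 < c₀) (hc₁ : 0 < c₁) (hτ0 : 0 < τ) (hτ1 : τ < 1) {s₀ s₁ : Fin n → ℝ}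
    (hs₀ : s₀ ∈ logImage K₀ + negOrthant n) (hs₁ : s₁ ∈ logImage K₁ + negOrthant n)
    {z : Fin n → ℂ} (hz : z ∈ torusPart {(1 - τ) • s₀ + τ • s₁}) :
    weightedGeodesic K₀ K₁ c₀ c₁ τ z ≤ ((-((1 - τ) * c₀ + τ * c₁) : ℝ) : EReal) := by
  have := weightedGeodesic_le_of_open (K₀ := K₀) (K₁ := K₁) hc₀ hc₁
    (Q₀ := logImage K₀ + negOrthant n) (Q₁ := logImage K₁ + negOrthant n)
    isOpen_negOrthant.add_left isOpen_negOrthant.add_left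
    (fun w hw => hK₀.mul_relExtremal_le hc₀ ⟨hw.1, hw.2.1⟩)
    (fun w hw => hK₁.mul_relExtremal_le hc₁ ⟨hw.1, hw.2.1⟩)
    ⟨hs₀, add_negOrthant_subset hK₀ hs₀⟩ ⟨hs₁, add_negOrthant_subset hK₁ hs₁⟩ hτ0 hτ1 hz
  convert this using 2
  ring

theorem IsAdmissible.nonempty_add (hK₀ : IsAdmissible K₀) :
    (logImage K₀ + negOrthant n).Nonempty :=
  hK₀.nonempty.add ⟨fun _ => -1, fun _ => by norm_num⟩

theorem mem_interpolatingSet_iff (hn : 1 ≤ n) (hK₀ : IsAdmissible K₀)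
    (hK₁ : IsAdmissible K₁) (hc₀ : 0 < c₀) (hc₁ : 0 < c₁) (hτ0 : 0 < τ) (hτ1 : τ < 1)
    {z : Fin n → ℂ} : z ∈ interpolatingSet K₀ K₁ c₀ c₁ τ ↔ z ∈ polydisc n ∧
      weightedGeodesic K₀ K₁ c₀ c₁ τ z = ((-((1 - τ) * c₀ + τ * c₁) : ℝ) : EReal) := by
  have hinf : ⨅ w ∈ polydisc n, weightedGeodesic K₀ K₁ c₀ c₁ τ w =
      ((-((1 - τ) * c₀ + τ * c₁) : ℝ) : EReal) := by
    refine le_antisymm ?_ (le_iInf₂ fun w _ =>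
      neg_weight_le_weightedGeodesic hn hK₀ hK₁ hc₀ hc₁ w)
    obtain ⟨s₀, hs₀⟩ := hK₀.nonempty_add
    obtain ⟨s₁, hs₁⟩ := hK₁.nonempty_add
    obtain ⟨w, hw⟩ := exists_mem_torusPart ((1 - τ) • s₀ + τ • s₁)
    have hwD : w ∈ polydisc n := mem_polydisc_of_torusPart (convex_negOrthant
      (add_negOrthant_subset hK₀ hs₀) (add_negOrthant_subset hK₁ hs₁)
      (by linarith) hτ0.le (by ring)) hw
    exact (iInf₂_le w hwD).trans
      (weightedGeodesic_le_neg_weight hK₀ hK₁ hc₀ hc₁ hτ0 hτ1 hs₀ hs₁ hw)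
  rw [interpolatingSet, mem_ofPred_eq, hinf]

theorem interpolatingSet_subset : interpolatingSet K₀ K₁ c₀ c₁ τ ⊆ polydisc n :=
  fun _ hz => hz.1

/-! ### Extremality of the geodesic forces proportional logarithmic images -/

/-- The normalization makes a·log|w| ≤ -c_τ on the interpolating set, so the form competes for its
extremal function, which is the geodesic by hypothesis. -/
theorem dotProduct_le_of_isExtremal (hn : 1 ≤ n) (hK₀ : IsAdmissible K₀) (hK₁ : IsAdmissible K₁)
    (hc₀ : 0 < c₀) (hc₁ : 0 < c₁) (hτ0 : 0 < τ) (hτ1 : τ < 1)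
    (h : ∀ z ∈ polydisc n, weightedGeodesic K₀ K₁ c₀ c₁ τ z =
      (((1 - τ) * c₀ + τ * c₁ : ℝ) : EReal) *
        relExtremal (polydisc n) (interpolatingSet K₀ K₁ c₀ c₁ τ) z)
    {a : Fin n → ℝ} (ha : a ∈ posOrthant n) {h₀ h₁ : ℝ}
    (hh₀ : ∀ x ∈ logImage K₀, a ⬝ᵥ x ≤ h₀) (hh₁ : ∀ x ∈ logImage K₁, a ⬝ᵥ x ≤ h₁)
    (hτh : (1 - τ) * h₀ + τ * h₁ = -((1 - τ) * c₀ + τ * c₁)) {z : Fin n → ℂ}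
    (hz : z ∈ torusPart (negOrthant n)) :
    ((a ⬝ᵥ logAbs z : ℝ) : EReal) ≤ weightedGeodesic K₀ K₁ c₀ c₁ τ z := by
  -- Shrinking the slope to εa makes the shifts e_j = -εh_j - c_j nonpositive, as the competitors
  -- require; ε cancels again on K_τ, where u_τ equals its floor.
  obtain ⟨ε, hε, hε₀, hε₁⟩ : ∃ ε > 0, -(ε * h₀) ≤ c₀ ∧ -(ε * h₁) ≤ c₁ := by
    have h1 : ∀ (x c : ℝ), 0 < c → ∀ᶠ ε : ℝ in 𝓝[>] 0, -(ε * x) ≤ c := fun x c hc => by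
      have : Tendsto (fun ε : ℝ => -(ε * x)) (𝓝[>] 0) (𝓝 0) := by
        have h2 : Continuous fun ε : ℝ => -(ε * x) := by fun_prop
        simpa using (h2.tendsto 0).mono_left nhdsWithin_le_nhds
      exact (this.eventually_lt_const hc).mono fun _ h => h.le
    obtain ⟨ε, ⟨h2, h3⟩, h4⟩ := (((h1 h₀ c₀ hc₀).and (h1 h₁ c₁ hc₁)).and
      self_mem_nhdsWithin).exists
    exact ⟨ε, h4, h2, h3⟩
  have hεa : ε • a ∈ posOrthant n := fun i => mul_pos hε (ha i)
  have hzD := torusPart_negOrthant_subset hz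
  have hle : ∀ w ∈ interpolatingSet K₀ K₁ c₀ c₁ τ, (∀ i, w i ≠ 0) →
      a ⬝ᵥ logAbs w + 0 ≤ -((1 - τ) * c₀ + τ * c₁) := fun w hw hw0 => by
    have h1 := (mem_interpolatingSet_iff hn hK₀ hK₁ hc₀ hc₁ hτ0 hτ1).1 hw
    have h2 := toricEnv_le_weightedGeodesic hK₀ hK₁ hc₀ hc₁ (singleton_subset_iff.2 hεa)
      (singleton_nonempty _) (e₀ := -(ε * h₀) - c₀) (e₁ := -(ε * h₁) - c₁) (by linarith)
      (by linarith) (by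
        rintro _ rfl x hx
        rw [smul_dotProduct, smul_eq_mul]
        linarith [mul_le_mul_of_nonneg_left (hh₀ x hx) hε.le]) (by
        rintro _ rfl x hx
        rw [smul_dotProduct, smul_eq_mul]
        linarith [mul_le_mul_of_nonneg_left (hh₁ x hx) hε.le]) w (τ := τ)
    have h3 := (le_toricEnv_of_mem (singleton_subset_iff.2 (posOrthant_subset hεa))
      (mem_singleton _) (-((1 - τ) * c₀ + τ * c₁)) ((1 - τ) * (-(ε * h₀) - c₀) +
        τ * (-(ε * h₁) - c₁)) h1.1 hw0).trans h2
    rw [h1.2, EReal.coe_le_coe_iff, smul_dotProduct, smul_eq_mul] at h3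
    have h4 : ε * (a ⬝ᵥ logAbs w) ≤ ε * -((1 - τ) * c₀ + τ * c₁) := by
      rw [← hτh]
      linarith
    linarith [le_of_mul_le_mul_left h4 hε]
  rw [h z hzD]
  refine le_trans ?_ (toricEnv_le_relExtremal interpolatingSet_subset
    (weight_pos hc₀ hc₁ hτ0 hτ1) le_rfl (singleton_subset_iff.2 ha) (singleton_nonempty _)
    (by rintro _ rfl; exact hle) hzD)
  have := le_toricEnv_of_mem (singleton_subset_iff.2 (posOrthant_subset ha))
    (mem_singleton _) (-((1 - τ) * c₀ + τ * c₁)) 0 hzD hz.1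
  rwa [add_zero] at this

theorem le_neg_of_forall_add_neg {a x : Fin n → ℝ} {θ c : ℝ} (hθ0 : 0 < θ)
    (h : ∀ ρ : ℝ, 0 < ρ → a ⬝ᵥ (θ • (x - ρ • (1 : Fin n → ℝ)) + (1 - θ) • -(ρ • (1 : Fin n → ℝ))) ≤ -(θ * c)) : a ⬝ᵥ x ≤ -c := by
  have h1 : ∀ ρ : ℝ, 0 < ρ → θ * (a ⬝ᵥ x) ≤ -(θ * c) + ρ * (a ⬝ᵥ 1) := fun ρ hρ => by
    have := h ρ hρ
    simp only [dotProduct_add, dotProduct_smul, dotProduct_sub, dotProduct_neg,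
      smul_eq_mul] at this
    linarith
  have h2 : Tendsto (fun ρ : ℝ => -(θ * c) + ρ * (a ⬝ᵥ 1)) (𝓝[>] 0) (𝓝 (-(θ * c))) := by
    have : Continuous fun ρ : ℝ => -(θ * c) + ρ * (a ⬝ᵥ 1) := by fun_prop
    simpa using (this.tendsto 0).mono_left nhdsWithin_le_nhds
  have h3 : θ * (a ⬝ᵥ x) ≤ -(θ * c) := ge_of_tendsto h2 (by
    filter_upwards [self_mem_nhdsWithin] with ρ hρ using h1 ρ hρ)
  have h4 : θ * (a ⬝ᵥ x) ≤ θ * -c := by linarith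
  exact le_of_mul_le_mul_left h4 hθ0

theorem neg_smul_one_mem {ρ : ℝ} (hρ : 0 < ρ) : -(ρ • (1 : Fin n → ℝ)) ∈ negOrthant n :=
  fun i => by simpa using hρ

/-- One endpoint is taken near Log K_j and the other near the origin, where only the bound 0 is
available; both are shifted by -ρ(1,…,1) into open sets, and ρ tends to 0. -/
theorem dotProduct_le_neg_of_isExtremal (hn : 1 ≤ n) (hK₀ : IsAdmissible K₀)
    (hK₁ : IsAdmissible K₁) (hc₀ : 0 < c₀) (hc₁ : 0 < c₁) (hτ0 : 0 < τ) (hτ1 : τ < 1)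
    (h : ∀ z ∈ polydisc n, weightedGeodesic K₀ K₁ c₀ c₁ τ z =
      (((1 - τ) * c₀ + τ * c₁ : ℝ) : EReal) *
        relExtremal (polydisc n) (interpolatingSet K₀ K₁ c₀ c₁ τ) z)
    {a : Fin n → ℝ} (ha : a ∈ posOrthant n) {h₀ h₁ : ℝ}
    (hh₀ : ∀ x ∈ logImage K₀, a ⬝ᵥ x ≤ h₀) (hh₁ : ∀ x ∈ logImage K₁, a ⬝ᵥ x ≤ h₁)
    (hτh : (1 - τ) * h₀ + τ * h₁ = -((1 - τ) * c₀ + τ * c₁)) :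
    (∀ x ∈ logImage K₀, a ⬝ᵥ x ≤ -c₀) ∧ (∀ x ∈ logImage K₁, a ⬝ᵥ x ≤ -c₁) := by
  have key : ∀ s₀ ∈ negOrthant n, ∀ s₁ ∈ negOrthant n, ∀ κ : ℝ,
      (∀ z ∈ torusPart {(1 - τ) • s₀ + τ • s₁}, weightedGeodesic K₀ K₁ c₀ c₁ τ z ≤ κ) →
      a ⬝ᵥ ((1 - τ) • s₀ + τ • s₁) ≤ κ := fun s₀ hs₀ s₁ hs₁ κ hκ => by
    obtain ⟨z, hz⟩ := exists_mem_torusPart ((1 - τ) • s₀ + τ • s₁)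
    have hzl : logAbs z = _ := hz.2
    have hmem := convex_negOrthant hs₀ hs₁ (sub_nonneg.2 hτ1.le) hτ0.le (by ring)
    have h1 := (dotProduct_le_of_isExtremal hn hK₀ hK₁ hc₀ hc₁ hτ0 hτ1 h ha hh₀ hh₁ hτh
      ⟨hz.1, by rw [hzl]; exact hmem⟩).trans (hκ z hz)
    rw [hzl] at h1
    exact EReal.coe_le_coe_iff.1 h1
  refine ⟨fun x hx => le_neg_of_forall_add_neg (θ := 1 - τ) (by linarith) fun ρ hρ => ?_,
    fun x hx => le_neg_of_forall_add_neg (θ := τ) hτ0 fun ρ hρ => ?_⟩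
  · have hx' : x - ρ • 1 ∈ logImage K₀ + negOrthant n := by
      rw [sub_eq_add_neg]; exact add_mem_add hx (neg_smul_one_mem hρ)
    rw [sub_sub_cancel]
    refine key _ (add_negOrthant_subset hK₀ hx') _ (neg_smul_one_mem hρ) _ fun z hz => ?_
    have := weightedGeodesic_le_of_open (K₀ := K₀) (K₁ := K₁) hc₀ hc₁
      (Q₀ := logImage K₀ + negOrthant n) (Q₁ := univ) (κ₁ := 0)
      isOpen_negOrthant.add_left isOpen_univ
      (fun w hw => hK₀.mul_relExtremal_le hc₀ ⟨hw.1, hw.2.1⟩)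
      (fun w hw => mul_relExtremal_nonpos K₁ hc₁ (torusPart_negOrthant_subset ⟨hw.1, hw.2.2⟩))
      ⟨hx', add_negOrthant_subset hK₀ hx'⟩ ⟨mem_univ _, neg_smul_one_mem hρ⟩ hτ0 hτ1 hz
    convert this using 2
    ring
  · have hx' : x - ρ • 1 ∈ logImage K₁ + negOrthant n := by
      rw [sub_eq_add_neg]; exact add_mem_add hx (neg_smul_one_mem hρ)
    rw [add_comm]
    refine key _ (neg_smul_one_mem hρ) _ (add_negOrthant_subset hK₁ hx') _ fun z hz => ?_
    have := weightedGeodesic_le_of_open (K₀ := K₀) (K₁ := K₁) hc₀ hc₁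
      (Q₀ := univ) (Q₁ := logImage K₁ + negOrthant n) (κ₀ := 0)
      isOpen_univ isOpen_negOrthant.add_left
      (fun w hw => mul_relExtremal_nonpos K₀ hc₀ (torusPart_negOrthant_subset ⟨hw.1, hw.2.2⟩))
      (fun w hw => hK₁.mul_relExtremal_le hc₁ ⟨hw.1, hw.2.1⟩)
      ⟨mem_univ _, neg_smul_one_mem hρ⟩ ⟨hx', add_negOrthant_subset hK₁ hx'⟩ hτ0 hτ1 hz
    convert this using 2
    ring

theorem IsAdmissible.exists_isLUB (hn : 1 ≤ n) (hK₀ : IsAdmissible K₀) {a : Fin n → ℝ}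
    (ha : a ∈ posOrthant n) : ∃ h < 0, IsLUB ((fun x => a ⬝ᵥ x) '' logImage K₀) h := by
  obtain ⟨δ, hδ, hle⟩ := exists_logImage_le hK₀.isCompact hK₀.subset
  have hub : -δ * ∑ i, a i ∈ upperBounds ((fun x => a ⬝ᵥ x) '' logImage K₀) := by
    rintro _ ⟨x, hx, rfl⟩
    rw [Finset.mul_sum]
    exact Finset.sum_le_sum fun i _ => by
      have := mul_le_mul_of_nonneg_left (hle x hx i) (ha i).le
      linarith
  have hlub := isLUB_csSup (hK₀.nonempty.image _) ⟨_, hub⟩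
  refine ⟨_, (hlub.2 hub).trans_lt ?_, hlub⟩
  have : Nonempty (Fin n) := ⟨⟨0, hn⟩⟩
  have hpos : 0 < ∑ i, a i := Finset.sum_pos (fun i _ => ha i) Finset.univ_nonempty
  nlinarith

theorem support_eq_of_isExtremal (hn : 1 ≤ n) (hK₀ : IsAdmissible K₀)
    (hK₁ : IsAdmissible K₁) (hc₀ : 0 < c₀) (hc₁ : 0 < c₁)
    (h : GeodesicIsExtremalSomewhere K₀ K₁ c₀ c₁)
    {a : Fin n → ℝ} (ha : a ∈ posOrthant n) {h₀ h₁ : ℝ} (hneg₀ : h₀ < 0) (hneg₁ : h₁ < 0)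
    (hh₀ : IsLUB ((fun x => a ⬝ᵥ x) '' logImage K₀) h₀)
    (hh₁ : IsLUB ((fun x => a ⬝ᵥ x) '' logImage K₁) h₁) : c₁ * h₀ = c₀ * h₁ := by
  obtain ⟨τ, hτ0, hτ1, h⟩ := h
  set H := (1 - τ) * h₀ + τ * h₁ with hH
  have hH0 : H < 0 := by
    have := mul_neg_of_pos_of_neg (sub_pos.2 hτ1) hneg₀
    have := mul_neg_of_pos_of_neg hτ0 hneg₁
    linarith
  have hw := weight_pos hc₀ hc₁ hτ0 hτ1
  set r := ((1 - τ) * c₀ + τ * c₁) / -H with hr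
  have hr0 : 0 < r := div_pos hw (by linarith)
  have hrH : r * H = -((1 - τ) * c₀ + τ * c₁) := by
    rw [hr, div_neg, neg_mul, div_mul_cancel₀ _ hH0.ne]
  have hra : r • a ∈ posOrthant n := fun i => mul_pos hr0 (ha i)
  obtain ⟨g₀, g₁⟩ := dotProduct_le_neg_of_isExtremal hn hK₀ hK₁ hc₀ hc₁ hτ0 hτ1 h hra
    (h₀ := r * h₀) (h₁ := r * h₁) (fun x hx => by
      rw [smul_dotProduct, smul_eq_mul]
      exact mul_le_mul_of_nonneg_left (hh₀.1 ⟨x, hx, rfl⟩) hr0.le) (fun x hx => by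
      rw [smul_dotProduct, smul_eq_mul]
      exact mul_le_mul_of_nonneg_left (hh₁.1 ⟨x, hx, rfl⟩) hr0.le) (by rw [← hrH, hH]; ring)
  have e₀ : h₀ ≤ -c₀ / r := hh₀.2 (by
    rintro _ ⟨x, hx, rfl⟩
    have := g₀ x hx
    rw [smul_dotProduct, smul_eq_mul] at this
    rw [le_div_iff₀ hr0]
    linarith)
  have e₁ : h₁ ≤ -c₁ / r := hh₁.2 (by
    rintro _ ⟨x, hx, rfl⟩
    have := g₁ x hx
    rw [smul_dotProduct, smul_eq_mul] at this
    rw [le_div_iff₀ hr0]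
    linarith)
  rw [le_div_iff₀ hr0] at e₀ e₁
  -- Both weighted inequalities add up to the equality `hrH`, so neither can be strict.
  have k₀ : h₀ * r = -c₀ := by nlinarith
  have k₁ : h₁ * r = -c₁ := by nlinarith
  have : (c₁ * h₀ - c₀ * h₁) * r = 0 := by linear_combination c₁ * k₀ - c₀ * k₁
  rcases mul_eq_zero.1 this with h2 | h2
  · linarith
  · exact absurd h2 hr0.ne'

theorem smul_logImage_subset (hn : 1 ≤ n) (hK₀ : IsAdmissible K₀)
    (hK₁ : IsAdmissible K₁) (hc₀ : 0 < c₀) (hc₁ : 0 < c₁)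
    (h : ∀ a ∈ posOrthant n, ∀ h₀ h₁ : ℝ, h₀ < 0 → h₁ < 0 →
      IsLUB ((fun x => a ⬝ᵥ x) '' logImage K₀) h₀ →
      IsLUB ((fun x => a ⬝ᵥ x) '' logImage K₁) h₁ → c₁ * h₀ = c₀ * h₁) :
    c₀ • logImage K₁ ⊆ c₁ • logImage K₀ := by
  rintro _ ⟨x, hx, rfl⟩
  suffices hmem : (c₀ / c₁) • x ∈ logImage K₀ by
    refine ⟨_, hmem, ?_⟩
    simp only [smul_smul, mul_div_cancel₀ _ hc₁.ne']
  by_contra hnot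
  obtain ⟨a, ha, m, hm, hlt⟩ := hK₀.exists_separating hnot
  obtain ⟨h₀, hneg₀, hh₀⟩ := hK₀.exists_isLUB hn ha
  obtain ⟨h₁, hneg₁, hh₁⟩ := hK₁.exists_isLUB hn ha
  have e := h a ha h₀ h₁ hneg₀ hneg₁ hh₀ hh₁
  have h1 : h₀ ≤ m := hh₀.2 (by rintro _ ⟨y, hy, rfl⟩; exact hm y hy)
  have h2 : a ⬝ᵥ x ≤ h₁ := hh₁.1 ⟨x, hx, rfl⟩
  rw [dotProduct_smul, smul_eq_mul] at hlt
  have h3 : c₀ / c₁ * (a ⬝ᵥ x) ≤ c₀ / c₁ * h₁ := by gcongr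
  have h4 : c₀ / c₁ * h₁ = h₀ := by
    rw [div_mul_eq_mul_div, ← e]; field_simp
  linarith

theorem smul_logImage_eq_of_isExtremal (hn : 1 ≤ n) (hK₀ : IsAdmissible K₀)
    (hK₁ : IsAdmissible K₁) (hc₀ : 0 < c₀) (hc₁ : 0 < c₁)
    (h : GeodesicIsExtremalSomewhere K₀ K₁ c₀ c₁) :
    c₀ • logImage K₁ = c₁ • logImage K₀ := by
  refine Subset.antisymm (smul_logImage_subset hn hK₀ hK₁ hc₀ hc₁ ?_)
    (smul_logImage_subset hn hK₁ hK₀ hc₁ hc₀ ?_)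
  · intro a ha h₀ h₁ n₀ n₁ l₀ l₁
    exact support_eq_of_isExtremal hn hK₀ hK₁ hc₀ hc₁ h ha n₀ n₁ l₀ l₁
  · intro a ha h₁ h₀ n₁ n₀ l₁ l₀
    exact (support_eq_of_isExtremal hn hK₀ hK₁ hc₀ hc₁ h ha n₀ n₁ l₀ l₁).symm

/-! ### Proportional logarithmic images make the geodesic extremal -/

/-- Positive linear forms that are at most `-c` on `L`. -/
def polarSet (L : Set (Fin n → ℝ)) (c : ℝ) : Set (Fin n → ℝ) :=
  {a | a ∈ posOrthant n ∧ ∀ x ∈ L, a ⬝ᵥ x ≤ -c}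

theorem polarSet_subset (L : Set (Fin n → ℝ)) (c : ℝ) : polarSet L c ⊆ posOrthant n :=
  fun _ ha => ha.1

theorem IsAdmissible.polarSet_nonempty (hn : 1 ≤ n) (hK₀ : IsAdmissible K₀) (hc₀ : 0 < c₀) :
    (polarSet (logImage K₀) c₀).Nonempty := by
  obtain ⟨δ, hδ, hle⟩ := exists_logImage_le hK₀.isCompact hK₀.subset
  have hpos : 0 < c₀ / δ := div_pos hc₀ hδ
  exact ⟨_, fun i => by simpa using hpos, exists_pos_dotProduct_le hn hδ hle le_rfl hpos⟩

/-- A bipolar argument: a form separating the dilated point from Log K, rescaled by c₀/(-m), would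
belong to the polar set and exceed -r' at s. The slack between r and r' moves the point into the
open set Log K + ℝⁿ₋. -/
theorem IsAdmissible.smul_mem_of_supLin_lt (hK₀ : IsAdmissible K₀) (hc₀ : 0 < c₀) {r : ℝ}
    (hr : 0 < r) {s : Fin n → ℝ} (hs : s ∈ negOrthant n)
    (h : supLin (polarSet (logImage K₀) c₀) s < -r) :
    (c₀ / r) • s ∈ logImage K₀ + negOrthant n := by
  obtain ⟨r', h1, h2⟩ := exists_between (lt_neg.1 h)
  have hr' : 0 < r' := hr.trans h1
  have hmem : (c₀ / r') • s ∈ logImage K₀ := by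
    by_contra hnot
    obtain ⟨a, ha, m, hm, hlt⟩ := hK₀.exists_separating hnot
    rw [dotProduct_smul, smul_eq_mul] at hlt
    have hdiv : 0 < c₀ / r' := div_pos hc₀ hr'
    have hm0 : m < 0 := hlt.trans_le (mul_nonpos_of_nonneg_of_nonpos hdiv.le
      (dotProduct_nonpos (posOrthant_subset ha) hs))
    have hq : 0 < c₀ / -m := div_pos hc₀ (by linarith)
    have ha' : (c₀ / -m) • a ∈ polarSet (logImage K₀) c₀ :=
      ⟨fun i => mul_pos hq (ha i), fun x hx => by
        rw [smul_dotProduct, smul_eq_mul]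
        have h3 := mul_le_mul_of_nonneg_left (hm x hx) hq.le
        have h4 : c₀ / -m * m = -c₀ := by rw [div_neg, neg_mul, div_mul_cancel₀ _ hm0.ne]
        linarith⟩
    have h5 := le_supLin ((polarSet_subset _ _).trans posOrthant_subset) ha' hs
    rw [smul_dotProduct, smul_eq_mul] at h5
    have h6 : -r' < c₀ / -m * (a ⬝ᵥ s) := by
      have h7 : r' / -m * m < r' / -m * (c₀ / r' * (a ⬝ᵥ s)) :=
        mul_lt_mul_of_pos_left hlt (div_pos hr' (by linarith))
      have h8 : r' / -m * m = -r' := by rw [div_neg, neg_mul, div_mul_cancel₀ _ hm0.ne]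
      have h9 : r' / -m * (c₀ / r' * (a ⬝ᵥ s)) = c₀ / -m * (a ⬝ᵥ s) := by field_simp
      rwa [h8, h9] at h7
    linarith
  have hsum : (c₀ / r) • s = (c₀ / r') • s + (c₀ / r - c₀ / r') • s := by
    rw [← add_smul]; congr 1; ring
  rw [hsum]
  have hlt : c₀ / r' < c₀ / r := by gcongr
  exact add_mem_add hmem fun i => mul_neg_of_pos_of_neg (sub_pos.2 hlt) (hs i)

/-- Homogeneity of `supLin` turns a bound on the floor set into a bound everywhere, by `ray_bound`.
It serves the geodesic with κ = c and the extremal function with κ = 1. -/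
theorem IsAdmissible.le_toricEnv_level (hn : 1 ≤ n) (hK₀ : IsAdmissible K₀) (hc₀ : 0 < c₀)
    {v : (Fin n → ℂ) → EReal} (hv : IsPlurisubharmonicOn v (polydisc n))
    (h0 : ∀ z ∈ polydisc n, v z ≤ 0) {c κ : ℝ} (hc : 0 < c) (hκ0 : 0 < κ)
    (hκ : ∀ z ∈ torusPart (negOrthant n), (c₀ / c) • logAbs z ∈ logImage K₀ + negOrthant n →
      v z ≤ ((-κ : ℝ) : EReal)) (k : ℕ) {z : Fin n → ℂ} (hz : z ∈ polydisc n) :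
    v z ≤ ((κ / c * max (-c) (supLin (polarSet (logImage K₀) c₀) (logTrunc k z)) : ℝ) :
      EReal) := by
  set P := polarSet (logImage K₀) c₀ with hP
  have hPn : P ⊆ nonnegOrthant n := (polarSet_subset _ _).trans posOrthant_subset
  refine le_of_le_on_torus hv (F := fun s => κ / c * max (-c) (supLin P s)) ?_ ?_ k hz
  · intro s s' hs' hss
    have := supLin_mono hPn (hK₀.polarSet_nonempty hn hc₀) hs' hss
    gcongr
  intro w hw
  have hwD := torusPart_negOrthant_subset hw
  rw [← EReal.le_of_forall_lt_iff_le]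
  intro y hy
  rw [EReal.coe_lt_coe_iff] at hy
  rcases le_or_gt 0 y with hy0 | hy0
  · exact (h0 w hwD).trans (EReal.coe_nonneg.2 hy0)
  -- The level r is chosen so that the ray parameter θ = r/c gives exactly -θκ = y.
  set r := -y * (c / κ) with hr
  have hr0 : 0 < r := mul_pos (by linarith) (div_pos hc hκ0)
  have hmax : max (-c) (supLin P (logAbs w)) < -r := by
    have h1 := mul_lt_mul_of_pos_left hy (div_pos hc hκ0)
    rw [← mul_assoc, show c / κ * (κ / c) = 1 by field_simp, one_mul] at h1
    rw [hr]
    linarith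
  rw [max_lt_iff] at hmax
  have hrc : r < c := by linarith
  have hmem := hK₀.smul_mem_of_supLin_lt hc₀ hr0 hw.2 hmax.2
  have := ray_bound hv h0 (Q := (fun s => (c₀ / c) • s) ⁻¹' (logImage K₀ + negOrthant n))
    ((isOpen_negOrthant (n := n)).add_left.preimage (by fun_prop)) (κ := κ)
    (fun x hx => hκ x ⟨hx.1, hx.2.2⟩ hx.2.1) hw.2 (θ := r / c) (div_pos hr0 hc)
    ((div_lt_one hc).2 hrc) (by
      rw [mem_preimage, smul_smul]
      convert hmem using 2
      field_simp) (z := w) ⟨hw.1, rfl⟩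
  convert this using 2
  rw [hr]
  field_simp

theorem isExtremal_of_smul_logImage_eq (hn : 1 ≤ n) (hK₀ : IsAdmissible K₀)
    (hK₁ : IsAdmissible K₁) (hc₀ : 0 < c₀) (hc₁ : 0 < c₁)
    (h : c₀ • logImage K₁ = c₁ • logImage K₀) :
    GeodesicIsExtremalSomewhere K₀ K₁ c₀ c₁ := by
  -- The argument works for every τ in (0,1); the midpoint only serves as a witness.
  obtain ⟨τ, hτ0, hτ1⟩ : ∃ τ : ℝ, 0 < τ ∧ τ < 1 := ⟨1 / 2, by norm_num, by norm_num⟩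
  refine ⟨τ, hτ0, hτ1, ?_⟩
  have hcpos := weight_pos hc₀ hc₁ hτ0 hτ1
  set c := (1 - τ) * c₀ + τ * c₁ with hc
  set P := polarSet (logImage K₀) c₀ with hP
  have hPpos : P ⊆ posOrthant n := polarSet_subset _ _
  have hPn : P ⊆ nonnegOrthant n := hPpos.trans posOrthant_subset
  have hPne : P.Nonempty := hK₀.polarSet_nonempty hn hc₀
  have hmem₁ : ∀ x ∈ logImage K₀, (c₁ / c₀) • x ∈ logImage K₁ := fun x hx => by
    have : c₁ • x ∈ c₀ • logImage K₁ := by rw [h]; exact smul_mem_smul_set hx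
    obtain ⟨y, hy, hyx⟩ := this
    have : (c₁ / c₀) • x = y := by
      rw [div_eq_inv_mul, ← smul_smul, ← hyx]
      exact inv_smul_smul₀ hc₀.ne' y
    rwa [this]
  have hP₁ : ∀ a ∈ P, ∀ x ∈ logImage K₁, a ⬝ᵥ x + 0 ≤ -c₁ := fun a ha x hx => by
    have : c₀ • x ∈ c₁ • logImage K₀ := by rw [← h]; exact smul_mem_smul_set hx
    obtain ⟨y, hy, hyx⟩ := this
    have h1 : c₁ * (a ⬝ᵥ y) = c₀ * (a ⬝ᵥ x) := by
      have := congrArg (fun s => a ⬝ᵥ s) hyx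
      simpa [dotProduct_smul] using this
    have h2 := mul_le_mul_of_nonneg_left (ha.2 y hy) hc₁.le
    have h3 : c₀ * (a ⬝ᵥ x) ≤ c₀ * -c₁ := by linarith
    linarith [le_of_mul_le_mul_left h3 hc₀]
  -- the sublevel torus points
  have hlevel : ∀ z ∈ torusPart (negOrthant n),
      (c₀ / c) • logAbs z ∈ logImage K₀ + negOrthant n →
      weightedGeodesic K₀ K₁ c₀ c₁ τ z ≤ ((-c : ℝ) : EReal) := fun z hz hzm => by
    set s₀ := (c₀ / c) • logAbs z with hs₀
    have hs₁ : (c₁ / c₀) • s₀ ∈ logImage K₁ + negOrthant n := by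
      obtain ⟨x, hx, y, hy, hxy⟩ := hzm
      rw [← hxy]
      dsimp only
      rw [smul_add]
      exact add_mem_add (hmem₁ x hx) fun i => mul_neg_of_pos_of_neg (div_pos hc₁ hc₀) (hy i)
    refine weightedGeodesic_le_neg_weight hK₀ hK₁ hc₀ hc₁ hτ0 hτ1 hzm hs₁ ⟨hz.1, ?_⟩
    rw [mem_singleton_iff, hs₀, smul_smul, smul_smul, smul_smul, ← add_smul]
    -- The point log|z| is the τ-combination of s₀ and (c₁/c₀)s₀, which lie over the two open floor
    -- sets.
    have : (1 - τ) * (c₀ / c) + τ * (c₁ / c₀) * (c₀ / c) = 1 := by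
      field_simp
      exact hc.symm
    rw [this, one_smul]
  have hge : ∀ z ∈ polydisc n, toricEnv P (-c) 0 z ≤ weightedGeodesic K₀ K₁ c₀ c₁ τ z :=
    fun z hz => by
      have := toricEnv_le_weightedGeodesic hK₀ hK₁ hc₀ hc₁ hPpos hPne le_rfl le_rfl
        (fun a ha x hx => by rw [add_zero]; exact ha.2 x hx) hP₁ z (τ := τ)
      rwa [mul_zero, mul_zero, add_zero] at this
  have hle : ∀ z ∈ polydisc n, weightedGeodesic K₀ K₁ c₀ c₁ τ z ≤ toricEnv P (-c) 0 z := by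
    intro z hz
    refine sSup_le ?_
    rintro _ ⟨u, hu, rfl⟩
    refine le_iInf fun k => ?_
    have hA := ofReal_exp_mem_annulus hτ0 hτ1
    have := hK₀.le_toricEnv_level hn hc₀ (hu.1.slice hA) (fun w hw => by
        have := geodesicClass_le_linear hu hw (A₀ := 0) (A₁ := 0)
          (mul_relExtremal_nonpos K₀ hc₀ hw) (mul_relExtremal_nonpos K₁ hc₁ hw) hA
        simpa using this) hcpos hcpos (fun w hw hwm =>
          (le_sSup ⟨u, hu, rfl⟩ : _ ≤ weightedGeodesic K₀ K₁ c₀ c₁ τ w).trans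
            (hlevel w hw hwm)) k hz
    rwa [div_self hcpos.ne', one_mul, ← add_zero (supLin _ _)] at this
  have hEq : ∀ z ∈ polydisc n, weightedGeodesic K₀ K₁ c₀ c₁ τ z = toricEnv P (-c) 0 z :=
    fun z hz => le_antisymm (hle z hz) (hge z hz)
  intro z hz
  rw [hEq z hz]
  refine le_antisymm (toricEnv_le_relExtremal interpolatingSet_subset hcpos le_rfl hPpos hPne
    (fun a ha w hw hw0 => ?_) hz) (le_iInf fun k => ?_)
  · have h1 := (mem_interpolatingSet_iff hn hK₀ hK₁ hc₀ hc₁ hτ0 hτ1).1 hw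
    have h2 := (le_toricEnv_of_mem hPn ha (-c) 0 h1.1 hw0).trans (hge w h1.1)
    rw [h1.2] at h2
    exact EReal.coe_le_coe_iff.1 h2
  · have henv : relExtremal (polydisc n) (interpolatingSet K₀ K₁ c₀ c₁ τ) z ≤
        ((1 / c * max (-c) (supLin P (logTrunc k z)) : ℝ) : EReal) := by
      refine relExtremal_le_of_mem_open (f := fun z =>
        ((1 / c * max (-c) (supLin P (logTrunc k z)) : ℝ) : EReal)) isOpen_polydisc hz ?_ ?_
      · refine (continuous_coe_real_ereal.comp_continuousOn (continuousOn_const.mul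
          (continuousOn_const.sup ((continuousOn_supLin hPn hPne).comp
            (continuous_logTrunc k).continuousOn fun w hw =>
              logTrunc_mem hw k)))).upperSemicontinuousOn
      · intro y hy
        refine sSup_le ?_
        rintro _ ⟨v, hv, hv0, hvK, rfl⟩
        refine hK₀.le_toricEnv_level hn hc₀ hv hv0 hcpos one_pos (fun w hw hwm => ?_) k hy
        have hwD := torusPart_negOrthant_subset hw
        have := hvK w ((mem_interpolatingSet_iff hn hK₀ hK₁ hc₀ hc₁ hτ0 hτ1).2 ⟨hwD,
          le_antisymm (hlevel w hw hwm)
            (neg_weight_le_weightedGeodesic hn hK₀ hK₁ hc₀ hc₁ w)⟩)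
        simpa using this
    refine (mul_le_mul_of_nonneg_left henv (EReal.coe_nonneg.2 hcpos.le)).trans ?_
    rw [← EReal.coe_mul, EReal.coe_le_coe_iff, ← mul_assoc, mul_one_div_cancel hcpos.ne',
      one_mul, add_zero]

end WeightedGeodesic

/-! ### Powers of Reinhardt sets -/

section Powers

variable {n : ℕ} {K₀ K₁ : Set (Fin n → ℂ)} {c₀ c₁ : ℝ}

/-- The modulus power with exponent c₀/c₁ > 0 is continuous across the hyperplanes, so mapping the
torus part of K₁ into the closed set K₀ suffices. -/
theorem reinhardtPow_subset (hK₀ : IsAdmissible K₀) (hK₁ : IsAdmissible K₁)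
    (hcl : IsClosureOfTorusPart K₁) (hc₀ : 0 < c₀) (hc₁ : 0 < c₁)
    (h : c₀ • logImage K₁ ⊆ c₁ • logImage K₀) : reinhardtPow K₁ c₀ ⊆ reinhardtPow K₀ c₁ := by
  have hcc : 0 < c₀ / c₁ := div_pos hc₀ hc₁
  set φ : (Fin n → ℂ) → Fin n → ℂ := fun z i => ((‖z i‖ ^ (c₀ / c₁) : ℝ) : ℂ) with hφ
  have hcont : Continuous φ := continuous_pi fun i => Complex.continuous_ofReal.comp
    (Continuous.rpow_const (by fun_prop) fun _ => Or.inr hcc.le)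
  have hmaps : MapsTo φ K₁ K₀ := by
    rw [hcl]
    refine fun z hz => hK₀.isCompact.isClosed.closure_subset (map_mem_closure hcont hz ?_)
    rintro w ⟨hw, hw0⟩
    have hmem : c₀ • logAbs w ∈ c₁ • logImage K₀ :=
      h (smul_mem_smul_set (logAbs_mem_logImage hK₁.subset hK₁.reinhardt hw hw0))
    obtain ⟨s, hs, hsw⟩ := hmem
    refine hK₀.reinhardt _ hs.2 _ fun i => ?_
    have h1 : c₁ * s i = c₀ * Real.log ‖w i‖ := congrFun hsw i
    have h2 : s i = Real.log ‖w i‖ * (c₀ / c₁) := by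
      field_simp
      linarith
    simp only [hφ]
    rw [Complex.norm_real, Complex.norm_real, Real.norm_of_nonneg (by positivity),
      Real.norm_of_nonneg (by positivity), h2, Real.rpow_def_of_pos (norm_pos_iff.2 (hw0 i))]
  rintro z ⟨η, hη, hz⟩
  refine ⟨φ η, hmaps hη, fun i => ?_⟩
  simp only [hφ]
  rw [hz i, Complex.norm_real, Real.norm_of_nonneg (by positivity),
    ← Real.rpow_mul (norm_nonneg _), div_mul_cancel₀ _ hc₁.ne']

theorem smul_logImage_subset_of_reinhardtPow (hK₀ : IsAdmissible K₀)
    (hc₁ : 0 < c₁) (h : reinhardtPow K₁ c₀ ⊆ reinhardtPow K₀ c₁) :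
    c₀ • logImage K₁ ⊆ c₁ • logImage K₀ := by
  rintro _ ⟨s, hs, rfl⟩
  have hmem : (fun i => ((Real.exp (c₀ * s i) : ℝ) : ℂ)) ∈ reinhardtPow K₁ c₀ :=
    ⟨_, hs.2, fun i => by
      rw [Complex.norm_real, Complex.norm_real, Real.norm_of_nonneg (Real.exp_pos _).le,
        Real.norm_of_nonneg (Real.exp_pos _).le, ← Real.exp_mul, mul_comm]⟩
  obtain ⟨η, hη, hz⟩ := h hmem
  have hz' : ∀ i, Real.exp (c₀ * s i) = ‖η i‖ ^ c₁ := fun i => by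
    rw [← hz i, Complex.norm_real, Real.norm_of_nonneg (Real.exp_pos _).le]
  have hη0 : ∀ i, η i ≠ 0 := fun i h0 => by
    have := hz' i
    rw [h0, norm_zero, Real.zero_rpow hc₁.ne'] at this
    exact (Real.exp_pos _).ne' this
  refine ⟨logAbs η, logAbs_mem_logImage hK₀.subset hK₀.reinhardt hη hη0, funext fun i => ?_⟩
  have h1 := congrArg Real.log (hz' i)
  rw [Real.log_exp, Real.log_rpow (norm_pos_iff.2 (hη0 i))] at h1
  simp only [logAbs, Pi.smul_apply, smul_eq_mul]
  exact h1.symm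

end Powers

theorem theorem4 (n : ℕ) (hn : 1 ≤ n) (K₀ K₁ : Set (Fin n → ℂ))
    (hK₀ : IsCompact K₀) (hK₁ : IsCompact K₁)
    (hK₀D : K₀ ⊆ polydisc n) (hK₁D : K₁ ⊆ polydisc n)
    (hK₀R : IsReinhardt K₀) (hK₁R : IsReinhardt K₁)
    (hK₀L : IsCompleteLogConvex K₀) (hK₁L : IsCompleteLogConvex K₁)
    (hK₀P : ¬ IsPluripolar K₀) (hK₁P : ¬ IsPluripolar K₁)
    (c₀ c₁ : ℝ) (hc₀ : 0 < c₀) (hc₁ : 0 < c₁) :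
    (GeodesicIsExtremalSomewhere K₀ K₁ c₀ c₁ ↔ c₀ • logImage K₁ = c₁ • logImage K₀) ∧
    (IsClosureOfTorusPart K₀ → IsClosureOfTorusPart K₁ →
      (GeodesicIsExtremalSomewhere K₀ K₁ c₀ c₁ ↔ reinhardtPow K₁ c₀ = reinhardtPow K₀ c₁)) := by
  have h₀ : IsAdmissible K₀ := ⟨hK₀, hK₀D, hK₀R, hK₀L, hK₀P⟩
  have h₁ : IsAdmissible K₁ := ⟨hK₁, hK₁D, hK₁R, hK₁L, hK₁P⟩
  have main : GeodesicIsExtremalSomewhere K₀ K₁ c₀ c₁ ↔ c₀ • logImage K₁ = c₁ • logImage K₀ :=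
    ⟨smul_logImage_eq_of_isExtremal hn h₀ h₁ hc₀ hc₁,
      isExtremal_of_smul_logImage_eq hn h₀ h₁ hc₀ hc₁⟩
  refine ⟨main, fun hcl₀ hcl₁ => main.trans ⟨fun h => ?_, fun h => ?_⟩⟩
  · exact Subset.antisymm (reinhardtPow_subset h₀ h₁ hcl₁ hc₀ hc₁ h.subset)
      (reinhardtPow_subset h₁ h₀ hcl₀ hc₁ hc₀ h.symm.subset)
  · exact Subset.antisymm (smul_logImage_subset_of_reinhardtPow h₀ hc₁ h.subset)
      (smul_logImage_subset_of_reinhardtPow h₁ hc₀ h.symm.subset)
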